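/- **Aztec diamond.** For $n\ge 0$ let $AD_n$ be the graph formed by the vertices and sides of the faces $(j,k)\in\mathbb Z^2$ with $|j|+|k|\le n-1$ of the lattice $(\mathbb Z+\frac12)^2$, with uniform edge weights. For a face $(j,k)$ of $AD_n$, let $p_E(j,k,n),p_N(j,k,n),p_W(j,k,n),p_S(j,k,n)$ be the probabilities that its east, north, west, south side is covered in a uniformly random dimer cover of $AD_n$. **Generalized tower graphs.** Let $f:\mathbb R\to\mathbb R$ satisfy $f(-1)=1$, let there be a smallest $x_*>-1$ with $f(x_*)=x_*$, and let $f$ be differentiable with $|f'|\le1$ on $[-1,x_*]$. Redefine $f(x)=-x$ for $x<-1$ and $f(x)=x$ for $x>x_*$. An up-down path is a function $H:\mathbb Z\to\mathbb Z$ with $H(c+1)-H(c)=\pm1$ for all $c$ and $H(c)=|c|-1$ for all large $|c|$, interpolated linearly to $\mathbb R$. Let $H^f_N$ be the largest up-down path with $\frac1{N+1}(H^f_N((N+1)x)+1)\le f(x)$ for all $x\in\mathbb R$. The graph of rank $N$ has the faces $(j,k)$ with $|j|+|k|<H^f_N(j+k)$, column $j+k$ having height $H^f_N(j+k)$. It is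 obtained from the empty graph, $H(c)=|c|-1$, by shuffling columns one at a time: a column $c$ with $H(c\pm1)=H(c)+1=:h$ may be shuffled, which changes $H(c)$ to $H(c)+2$. The positions $\widetilde{\mathcal T}(j,k)$ of the faces in the perfect t-embedding of the reduced graph are obtained at the same time: on shuffling column $c$, each face $(j,k)$ of that column with $|j|+|k|<h$ moves by $$\widetilde{\mathcal T}^{\rm new}(j,k)+\widetilde{\mathcal T}^{\rm old}(j,k)=\tfrac12\sum_{(j',k')\sim(j,k)}\widetilde{\mathcal T}(j',k'),$$ each new face with $|j|+|k|=h$ and $jk\ne0$ is placed at the midpoint of its two neighbouring faces in the graph, the new faces $(h,0),(0,h),(-h,0),(0,-h)$ with $h>0$ are placed at the midpoints of $b$ and their neighbouring face in the graph, where $b=1,\mathrm i,-1,-\mathrm i$ respectively, and the first face $(0,0)$ is placed at $0$. **Statement.** Let $n\ge0$, let $N\in\{n,n+1\}$, let $(j,k)$ be a face of the graph of rank $N$ approximating $f$, put $r=r(n;j,k)=H^f_N(j+k)$ (so $r+j+k$ is odd and $(j,k)$ is a face of $AD_r$), and define $\epsilon=\epsilon(j,k)$ by $r=(n+1)f\left(\frac{j+k}{n+1}\right)+\epsilon$.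 Let $(x,y)=\frac1{n+1}(j,k)$ and $$\widetilde S(z)=\tfrac12(f(x+y)+x+y)\log z-\tfrac12(f(x+y)-x+y)\log(z+1)-\tfrac12(f(x+y)+x-y)\log(z-1).$$ Let $\mathcal E_1,\mathcal E_2$ be positively oriented circles around $0$ and $1$, of radii strictly between $0$ and $\frac12$. For a function $g$ put $$I[g]=\frac1{(2\pi\mathrm i)^2}\int_{\mathcal E_2}\int_{\mathcal E_1}\mathrm e^{(n+1)(\widetilde S(w)-\widetilde S(z))}\,g(z,w)\left(\frac{w(1+z)(z-1)}{z(1+w)(w-1)}\right)^{\frac{\epsilon+1}2}\frac{\mathrm dz\,\mathrm dw}{z-w},$$ where the power is taken with the same determinations of $\log z,\log(z+1),\log(z-1)$ (and of the same functions of $w$) as in $\widetilde S$; the formulas hold for every choice of these determinations. Then $$p_E(j,k,r)=I\left[\tfrac1{1+z}\right],\qquad p_N(j,k,r)=-I\left[\tfrac1{z-1}\right],$$ $$p_W(j,k,r)=I\left[\tfrac1{w(z-1)}\right]+1,\qquad p_S(j,k,r)=I\left[\tfrac1{w(1+z)}\right].$$ Moreover the graph of rank $N$ and its t-embedding $\widetilde{\mathcal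 T}$ can be reached by such a sequence of shuffles, and for every such sequence the resulting position of the face $(j,k)$ is $$\widetilde{\mathcal T}(j,k)=I[G_{\mathcal T}]-1,\qquad G_{\mathcal T}(z,w)=\frac{(1-\mathrm i)(z-\mathrm i)(w-\mathrm i)}{(z-1)(z+1)w}.$$ For $N=n+1$ this is the formula for $\widetilde{\mathcal T}_n(j,k)$, where $\widetilde{\mathcal T}_n$ is the t-embedding of the reduced generalized tower graph of rank $n+1$. -/

import Mathlib

open Complex Set

noncomputable section

namespace Tower

/-! ### The Aztec diamond and its edge probabilities

Faces of the lattice `(ℤ + 1/2)²` are indexed by their centres `(j, k) ∈ ℤ²`; the lattice vertex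
`(a + 1/2, b + 1/2)` is represented by the integer pair `(a, b)`. -/

/-- A vertex `(a + 1/2, b + 1/2)` of the square lattice, represented by `(a, b)`. -/
abbrev Vertex := ℤ × ℤ

/-- The east edge of the face `(j, k)`, from `(j + 1/2, k - 1/2)` to `(j + 1/2, k + 1/2)`. -/
def eastEdge (j k : ℤ) : Sym2 Vertex := s((j, k - 1), (j, k))

/-- The north edge of the face `(j, k)`, from `(j - 1/2, k + 1/2)` to `(j + 1/2, k + 1/2)`. -/
def northEdge (j k : ℤ) : Sym2 Vertex := s((j - 1, k), (j, k))

/-- The west edge of the face `(j, k)`, from `(j - 1/2, k - 1/2)` to `(j - 1/2, k + 1/2)`. -/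
def westEdge (j k : ℤ) : Sym2 Vertex := s((j - 1, k - 1), (j - 1, k))

/-- The south edge of the face `(j, k)`, from `(j - 1/2, k - 1/2)` to `(j + 1/2, k - 1/2)`. -/
def southEdge (j k : ℤ) : Sym2 Vertex := s((j - 1, k - 1), (j, k - 1))

/-- The faces `|j| + |k| ≤ n - 1` of the Aztec diamond of rank `n`. -/
def aztecFaces (n : ℕ) : Finset (ℤ × ℤ) :=
  (Finset.Icc (-(n : ℤ)) n ×ˢ Finset.Icc (-(n : ℤ)) n).filter
    (fun p => |p.1| + |p.2| ≤ (n : ℤ) - 1)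

/-- The vertices of the Aztec diamond: the corners of its faces. -/
def aztecVertices (n : ℕ) : Finset Vertex :=
  (aztecFaces n).biUnion
    (fun p => {(p.1 - 1, p.2 - 1), (p.1 - 1, p.2), (p.1, p.2 - 1), (p.1, p.2)})

/-- The edges of the Aztec diamond: the sides of its faces. -/
def aztecEdges (n : ℕ) : Finset (Sym2 Vertex) :=
  (aztecFaces n).biUnion
    (fun p => {eastEdge p.1 p.2, northEdge p.1 p.2, westEdge p.1 p.2, southEdge p.1 p.2})

/-- The dimer covers of the Aztec diamond: sets of edges such that each vertex lies on exactly one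
edge of the set. -/
def aztecDimerCovers (n : ℕ) : Finset (Finset (Sym2 Vertex)) :=
  (aztecEdges n).powerset.filter
    (fun m => ∀ v ∈ aztecVertices n, (m.filter (fun e => v ∈ e)).card = 1)

/-- The probability that the edge `e` is covered, in the dimer model with uniform weights on the
Aztec diamond of rank `n` (all dimer covers are equally likely). -/
def edgeProb (n : ℕ) (e : Sym2 Vertex) : ℝ :=
  (((aztecDimerCovers n).filter (fun m => e ∈ m)).card : ℝ) / ((aztecDimerCovers n).card : ℝ)

/-- The probability `p_E(j, k, n)`. -/
def pE (j k : ℤ) (n : ℕ) : ℝ := edgeProb n (eastEdge j k)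

/-- The probability `p_N(j, k, n)`. -/
def pN (j k : ℤ) (n : ℕ) : ℝ := edgeProb n (northEdge j k)

/-- The probability `p_W(j, k, n)`. -/
def pW (j k : ℤ) (n : ℕ) : ℝ := edgeProb n (westEdge j k)

/-- The probability `p_S(j, k, n)`. -/
def pS (j k : ℤ) (n : ℕ) : ℝ := edgeProb n (southEdge j k)

/-! ### Up-down paths approximating a function -/

/-- The conditions on `f`: `f(-1) = 1`, the number `xs` is the smallest `x > -1` with `f x = x`, and
`f` is differentiable with `|f'| ≤ 1` on `[-1, xs]`. -/
structure IsProfile (f : ℝ → ℝ) (xs : ℝ) : Prop where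
  map_neg_one : f (-1) = 1
  isLeast_fixed : IsLeast {x : ℝ | -1 < x ∧ f x = x} xs
  abs_deriv_le : ∀ x ∈ Icc (-1) xs, ∃ d : ℝ, HasDerivWithinAt f d (Icc (-1) xs) x ∧ |d| ≤ 1

/-- The extension of `f` from `[-1, xs]` by `-x` to the left and by `x` to the right. -/
def extend (f : ℝ → ℝ) (xs : ℝ) (x : ℝ) : ℝ :=
  if x < -1 then -x else if x ≤ xs then f x else x

/-- The up-down path of the empty graph. -/
def emptyPath (c : ℤ) : ℤ := |c| - 1

/-- Up-down paths: steps `±1`, and equal to the path of the empty graph far from the origin. -/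
def IsUpDownPath (H : ℤ → ℤ) : Prop :=
  (∀ c, H (c + 1) - H c = 1 ∨ H (c + 1) - H c = -1) ∧ ∃ L : ℤ, ∀ c, L ≤ |c| → H c = emptyPath c

/-- Linear interpolation of a path between the integers. -/
def interpolate (H : ℤ → ℤ) (x : ℝ) : ℝ :=
  (H ⌊x⌋ : ℝ) + Int.fract x * ((H (⌊x⌋ + 1) : ℝ) - (H ⌊x⌋ : ℝ))

/-- `H` is the path `H_N^f` of the generalized tower graph of rank `N` approximating `f`: the
largest up-down path below the rescaled graph of the extension of `f`. -/
def IsApproxPath (f : ℝ → ℝ) (xs : ℝ) (N : ℕ) (H : ℤ → ℤ) : Prop :=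
  IsGreatest {H' : ℤ → ℤ | IsUpDownPath H' ∧
    ∀ x : ℝ, 1 / ((N : ℝ) + 1) * (interpolate H' (((N : ℝ) + 1) * x) + 1) ≤ extend f xs x} H

/-- `(j, k)` is a face of the graph with column heights `H`. The columns of the graph are
the `c` with `H c > |c| - 1`, and column `c` consists of the `H c` faces with
`j + k = c` and `|j - k| ≤ H c - 1`; as `max |j + k| |j - k| = |j| + |k|`, these are the faces with
`|j| + |k| < H (j + k)`. -/
def IsFace (H : ℤ → ℤ) (j k : ℤ) : Prop := |j| + |k| < H (j + k)

/-! ### The t-embedding constructed by column shuffling -/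

open Classical in
/-- The value used for the neighbour `(j, k)` of a shuffled face: the current position
`T j k` if `(j, k)` is a face of the current graph; outside the graph, the four boundary values
`1, i, -1, -i` (the outer vertices of the augmented dual) on the positive and negative half-axes,
and `0` elsewhere. -/
def neighborValue (H : ℤ → ℤ) (T : ℤ → ℤ → ℂ) (j k : ℤ) : ℂ :=
  if IsFace H j k then T j k
  else if k = 0 ∧ 0 < j then 1
  else if j = 0 ∧ 0 < k then I
  else if k = 0 ∧ j < 0 then -1
  else if j = 0 ∧ k < 0 then -I
  else 0

/-- The path after an upward corner flip at `c`. -/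
def flip (H : ℤ → ℤ) (c : ℤ) : ℤ → ℤ := Function.update H c (H c + 2)

open Classical in
/-- The positions of the faces after shuffling column `c`. Each face of the new column `c` moves by
the central move `T_new + T_old = (sum of the four neighbours) / 2`, all other faces stay.
A face at an end of the new column was not in the graph before and has `T_old = 0`; for it the rule
says that it is put at the midpoint of its two neighbours in the graph (or, at a corner
`(±h, 0)`, `(0, ±h)` with `h > 0`, of its neighbour in the graph and the boundary value; the
very first face `(0, 0)` is put at `0`). -/
def shuffle (H : ℤ → ℤ) (T : ℤ → ℤ → ℂ) (c : ℤ) (j k : ℤ) : ℂ :=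
  if j + k = c ∧ IsFace (flip H c) j k then
    (neighborValue H T (j + 1) k + neighborValue H T (j - 1) k
      + neighborValue H T j (k + 1) + neighborValue H T j (k - 1)) / 2 - T j k
  else T j k

/-- `IsTEmbedding H T`: starting from the empty graph and shuffling shufflable columns
one at a time, in some order, one reaches the graph with column heights `H`, and `T j k` is the
resulting position of the face `(j, k)` in the perfect t-embedding of its reduced graph. -/
inductive IsTEmbedding : (ℤ → ℤ) → (ℤ → ℤ → ℂ) → Prop
  | empty : IsTEmbedding emptyPath (fun _ _ => 0)
  | step (H : ℤ → ℤ) (T : ℤ → ℤ → ℂ) (c : ℤ) (hT : IsTEmbedding H T)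
      (hl : H (c - 1) = H c + 1) (hr : H (c + 1) = H c + 1) :
      IsTEmbedding (flip H c) (shuffle H T c)

/-! ### The quantities in the contour integrals -/

/-- The index `r` at the face `(j, k)` of the graph with column heights `H`: the Aztec diamonds
whose column `j + k` has height `H (j + k)` are those of rank `H (j + k)` and `H (j + k) + 1`, and
the index is the one of odd parity `r + j + k`, that is `r = H (j + k)`. -/
def rIndex (H : ℤ → ℤ) (j k : ℤ) : ℕ := (H (j + k)).toNat

/-- The error `ε(j, k)`, defined by `r = (n + 1) f((j + k) / (n + 1)) + ε(j, k)`. -/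
def eps (f : ℝ → ℝ) (xs : ℝ) (n : ℕ) (H : ℤ → ℤ) (j k : ℤ) : ℝ :=
  (rIndex H j k : ℝ) - ((n : ℝ) + 1) * extend f xs (((j : ℝ) + (k : ℝ)) / ((n : ℝ) + 1))

/-- A (not necessarily continuous) determination of the logarithm. -/
def IsLogBranch (l : ℂ → ℂ) : Prop := ∀ z : ℂ, z ≠ 0 → exp (l z) = z

/-- The modified action `S̃(z; x, y)`; `l₀, l₁, l₂` are the determinations of the logarithm used for
`log z`, `log (z + 1)` and `log (z - 1)`. -/
def action (f : ℝ → ℝ) (xs : ℝ) (l₀ l₁ l₂ : ℂ → ℂ) (x y : ℝ) (z : ℂ) : ℂ :=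
  1 / 2 * ((extend f xs (x + y) + x + y : ℝ) : ℂ) * l₀ z
    - 1 / 2 * ((extend f xs (x + y) - x + y : ℝ) : ℂ) * l₁ (z + 1)
    - 1 / 2 * ((extend f xs (x + y) + x - y : ℝ) : ℂ) * l₂ (z - 1)

/-- The power `(w (1 + z) (z - 1) / (z (1 + w) (w - 1))) ^ a`, taken with the logarithm
of the base given by the same determinations `l₀, l₁, l₂`. -/
def correction (l₀ l₁ l₂ : ℂ → ℂ) (a : ℝ) (z w : ℂ) : ℂ :=
  exp ((a : ℂ) * (l₀ w + l₁ (z + 1) + l₂ (z - 1) - l₀ z - l₁ (w + 1) - l₂ (w - 1)))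

/-- `(2 π i)⁻² ∫_{ℰ₂} ∫_{ℰ₁} g(z, w) dz dw`, where `ℰ₁` and `ℰ₂` are the positively oriented circles
of radius `ρ₁` around `0` and of radius `ρ₂` around `1`. -/
def doubleContour (ρ₁ ρ₂ : ℝ) (g : ℂ → ℂ → ℂ) : ℂ :=
  1 / (2 * (Real.pi : ℂ) * I) ^ 2 * ∮ w in C(1, ρ₂), ∮ z in C(0, ρ₁), g z w

/-- The double contour integral
`(2 π i)⁻² ∫∫ exp ((n + 1) (S̃(w) - S̃(z))) g(z, w) (correction) ^ ((ε + 1) / 2) dz dw / (z - w)`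
at `(x, y) = (j, k) / (n + 1)`. -/
def contourFormula (f : ℝ → ℝ) (xs : ℝ) (n : ℕ) (H : ℤ → ℤ) (l₀ l₁ l₂ : ℂ → ℂ) (ρ₁ ρ₂ : ℝ)
    (j k : ℤ) (g : ℂ → ℂ → ℂ) : ℂ :=
  doubleContour ρ₁ ρ₂ (fun z w =>
    exp (((n : ℂ) + 1) *
        (action f xs l₀ l₁ l₂ ((j : ℝ) / ((n : ℝ) + 1)) ((k : ℝ) / ((n : ℝ) + 1)) w
          - action f xs l₀ l₁ l₂ ((j : ℝ) / ((n : ℝ) + 1)) ((k : ℝ) / ((n : ℝ) + 1)) z))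
      * g z w * correction l₀ l₁ l₂ ((eps f xs n H j k + 1) / 2) z w * (1 / (z - w)))

/-- The function `G_𝒯(z, w)`. -/
def GT (z w : ℂ) : ℂ := (1 - I) * (z - I) * (w - I) / ((z - 1) * (z + 1) * w)

end Tower

end

/-!
The exponential and the correction factor in the integrand combine, for every determination of the
logarithms, to `wᵃ (w + 1)⁻ᵇ (w - 1)⁻ᶜ` over the same expression in `z`, where `a, b, c` are the
natural numbers `(r + 1 + j + k) / 2`, `(r + 1 - j + k) / 2`, `(r + 1 + j - k) / 2`
(`contourFormula_eq_moment`). With `d = (r + 1 - j - k) / 2` one has `a + d = b + c`, and `(j, k)`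
is a face of the Aztec diamond of rank `r` iff all four are positive. So everything is a statement
about the rational double contour integrals `moment ρ₁ ρ₂ a b c g`, and is proved by recurrence.

*Edge probabilities.* Domino shuffling gives, at a face `(j, k)` with `j + k + n` even, the
recurrence `p_E(j, k, n + 1) = p_W(j, k, n) + (1 - (p_E + p_N + p_W + p_S)(j, k, n)) / 2` and its
rotations (`edgeProb_succ`). The sides of these faces partition the edges of the Aztec diamond of
rank `n + 1`, so a dimer cover of rank `n` or `n + 1` is a choice of a state for each of them.
Whether a choice is a cover depends only on the profiles, that is on the set of covered corners of
each face, and complementing all profiles exchanges the covers of rank `n` with those of rank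
`n + 1`. Given the profiles, the states of the faces are independent, with two choices for a face all
of whose corners are covered; as the total number of covered corners is fixed, the numbers of
choices before and after complementation differ by a factor that does not depend on the profiles.

The side of an even face is a side of the neighbouring odd face, so the recurrence only involves
faces of one colour class, and there the four kernels satisfy it pointwise: in the sum of the four
kernels the factor `z - w` cancels (`moment_shuffle`). At the faces just outside the diamond that
enter the recurrence one of `a, b, c, d` vanishes, and the integral has the value required there,
which is `-1` for `p_W` and `0` for the others: for `a = 0` or `c = 0` there is no pole at `z = 0`
or `w = 1`, and for `b = 0` or `d = 0` one of the two integrations can be evaluated by the pole at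
`z = w`, there being no pole at infinity.

*Positions.* The kernel itself satisfies the discrete wave equation, whatever the factor `g`
(`moment_wave`), which is the rule for the central moves. The residue calculus again gives the
integrals at the faces just outside the graph (`1 ± i`, `0`, and `2ᵃ` beyond the east corner). They
differ from the boundary values of the shuffling rule, but the differences cancel
(`moment_GT_shuffle`). A sequence of shuffles exists since an up-down path other than that of the
empty graph can be lowered at a local maximum (`IsUpDownPath.exists_isTEmbedding`).
-/

noncomputable section

namespace Tower

/-! ### Double contour integrals with continuous kernels -/

/-- The kernel `g` is continuous on the product of the two contours. -/
def ContourContinuous (ρ₁ ρ₂ : ℝ) (g : ℂ → ℂ → ℂ) : Prop :=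
  ContinuousOn (fun p : ℂ × ℂ => g p.1 p.2) (Metric.sphere 0 ρ₁ ×ˢ Metric.sphere 1 ρ₂)

section
variable {ρ₁ ρ₂ : ℝ} {g g' : ℂ → ℂ → ℂ}

theorem ContourContinuous.comp_circleMap (hg : ContourContinuous ρ₁ ρ₂ g) (h₁ : 0 ≤ ρ₁)
    (h₂ : 0 ≤ ρ₂) :
    Continuous fun p : ℝ × ℝ => g (circleMap 0 ρ₁ p.1) (circleMap 1 ρ₂ p.2) := by
  have hc : Continuous fun p : ℝ × ℝ => (circleMap 0 ρ₁ p.1, circleMap 1 ρ₂ p.2) :=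
    ((continuous_circleMap 0 ρ₁).comp continuous_fst).prodMk
      ((continuous_circleMap 1 ρ₂).comp continuous_snd)
  exact ContinuousOn.comp_continuous hg hc
    fun p => ⟨circleMap_mem_sphere 0 h₁ p.1, circleMap_mem_sphere 1 h₂ p.2⟩

theorem ContourContinuous.inner_circleIntegrable (hg : ContourContinuous ρ₁ ρ₂ g) (h₁ : 0 ≤ ρ₁)
    {w : ℂ} (hw : w ∈ Metric.sphere 1 ρ₂) : CircleIntegrable (fun z => g z w) 0 ρ₁ := by
  refine ContinuousOn.circleIntegrable h₁ ?_
  exact ContinuousOn.comp (f := fun z : ℂ => (z, w)) hg (by fun_prop) fun z hz => ⟨hz, hw⟩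

theorem ContourContinuous.outer_circleIntegrable (hg : ContourContinuous ρ₁ ρ₂ g) (h₁ : 0 ≤ ρ₁)
    (h₂ : 0 ≤ ρ₂) : CircleIntegrable (fun w => ∮ z in C(0, ρ₁), g z w) 1 ρ₂ := by
  refine Continuous.intervalIntegrable ?_ _ _
  simp only [circleIntegral, deriv_circleMap, smul_eq_mul]
  apply intervalIntegral.continuous_parametric_intervalIntegral_of_continuous'
  have h := hg.comp_circleMap h₁ h₂
  have h' : Continuous fun p : ℝ × ℝ => g (circleMap 0 ρ₁ p.2) (circleMap 1 ρ₂ p.1) :=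
    h.comp continuous_swap
  have h'' : Continuous fun p : ℝ × ℝ => circleMap 0 ρ₁ p.2 :=
    (continuous_circleMap 0 ρ₁).comp continuous_snd
  exact (h''.mul continuous_const).mul h'

theorem doubleContour_congr (h₁ : 0 ≤ ρ₁) (h₂ : 0 ≤ ρ₂)
    (h : ∀ z ∈ Metric.sphere (0 : ℂ) ρ₁, ∀ w ∈ Metric.sphere (1 : ℂ) ρ₂, g z w = g' z w) :
    doubleContour ρ₁ ρ₂ g = doubleContour ρ₁ ρ₂ g' := by
  unfold doubleContour
  congr 1
  refine circleIntegral.integral_congr h₂ fun w hw => ?_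
  exact circleIntegral.integral_congr h₁ fun z hz => h z hz w hw

theorem doubleContour_add (h₁ : 0 ≤ ρ₁) (h₂ : 0 ≤ ρ₂) (hg : ContourContinuous ρ₁ ρ₂ g)
    (hg' : ContourContinuous ρ₁ ρ₂ g') :
    doubleContour ρ₁ ρ₂ (fun z w => g z w + g' z w) =
      doubleContour ρ₁ ρ₂ g + doubleContour ρ₁ ρ₂ g' := by
  unfold doubleContour
  rw [← mul_add, ← circleIntegral.integral_add (hg.outer_circleIntegrable h₁ h₂)
    (hg'.outer_circleIntegrable h₁ h₂)]
  congr 1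
  refine circleIntegral.integral_congr h₂ fun w hw => ?_
  exact circleIntegral.integral_add (hg.inner_circleIntegrable h₁ hw)
    (hg'.inner_circleIntegrable h₁ hw)

theorem doubleContour_const_mul (a : ℂ) :
    doubleContour ρ₁ ρ₂ (fun z w => a * g z w) = a * doubleContour ρ₁ ρ₂ g := by
  unfold doubleContour
  simp only [circleIntegral.integral_const_mul]
  ring

theorem doubleContour_swap (h₁ : 0 ≤ ρ₁) (h₂ : 0 ≤ ρ₂) (hg : ContourContinuous ρ₁ ρ₂ g) :
    doubleContour ρ₁ ρ₂ g =
      1 / (2 * (Real.pi : ℂ) * I) ^ 2 * ∮ z in C(0, ρ₁), ∮ w in C(1, ρ₂), g z w := by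
  unfold doubleContour
  congr 1
  have h2π : (0 : ℝ) ≤ 2 * Real.pi := by positivity
  simp only [circleIntegral, deriv_circleMap, smul_eq_mul,
    intervalIntegral.integral_of_le h2π, ← MeasureTheory.integral_const_mul]
  rw [MeasureTheory.integral_integral_swap]
  · refine MeasureTheory.integral_congr_ae (.of_forall fun x => ?_)
    refine MeasureTheory.integral_congr_ae (.of_forall fun y => ?_)
    simp only
    ring
  · have h' : Continuous fun p : ℝ × ℝ => g (circleMap 0 ρ₁ p.2) (circleMap 1 ρ₂ p.1) :=
      (hg.comp_circleMap h₁ h₂).comp continuous_swap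
    have hc₁ : Continuous fun p : ℝ × ℝ => circleMap 0 ρ₁ p.2 :=
      (continuous_circleMap 0 ρ₁).comp continuous_snd
    have hc₂ : Continuous fun p : ℝ × ℝ => circleMap 0 ρ₂ p.1 :=
      (continuous_circleMap 0 ρ₂).comp continuous_fst
    have hc := (hc₂.mul (continuous_const (y := I))).mul
      ((hc₁.mul (continuous_const (y := I))).mul h')
    rw [MeasureTheory.Measure.prod_restrict]
    exact (hc.continuousOn.integrableOn_compact (isCompact_Icc.prod isCompact_Icc)).mono_set
      (Set.prod_mono Ioc_subset_Icc_self Ioc_subset_Icc_self)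

end

/-! ### One-variable residue computations -/

theorem sub_ne_zero_of_mem {ρ : ℝ} (hρ : 0 < ρ) {p w : ℂ} (hw : w ∈ Metric.sphere p ρ) :
    w - p ≠ 0 := by
  intro h
  rw [sub_eq_zero.1 h] at hw
  simp at hw; exact hρ.ne hw

theorem sub_ne_zero_of_notMem {ρ : ℝ} {p q w : ℂ} (hq : q ∉ Metric.closedBall p ρ)
    (hw : w ∈ Metric.sphere p ρ) : q - w ≠ 0 := by
  intro h
  rw [sub_eq_zero.1 h] at hq
  exact hq (Metric.sphere_subset_closedBall hw)

theorem circleIntegral_sub_inv_pow_div {ρ : ℝ} (hρ : 0 < ρ) {p q : ℂ}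
    (hq : q ∉ Metric.closedBall p ρ) (m : ℕ) :
    ∮ w in C(p, ρ), 1 / ((w - p) ^ (m + 1) * (q - w)) = 2 * Real.pi * I / (q - p) ^ (m + 1) := by
  have hpq : q - p ≠ 0 := by
    intro h; apply hq; rw [sub_eq_zero.1 h]; simp [hρ.le]
  have hw0 : ∀ w ∈ Metric.sphere p ρ, w - p ≠ 0 := fun w hw => sub_ne_zero_of_mem hρ hw
  have hw1 : ∀ w ∈ Metric.closedBall p ρ, q - w ≠ 0 := by
    intro w hw h
    rw [sub_eq_zero.1 h] at hq
    exact hq hw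
  have hanal : ∮ w in C(p, ρ), 1 / (q - w) = 0 := by
    refine circleIntegral_eq_zero_of_differentiable_on_off_countable hρ.le countable_empty ?_ ?_
    · exact continuousOn_const.div (by fun_prop) hw1
    · intro w hw
      exact (differentiableAt_const _).div (by fun_prop)
        (hw1 w (Metric.ball_subset_closedBall hw.1))
  have hci : ∀ k l : ℕ, CircleIntegrable (fun w => 1 / ((w - p) ^ k * (q - w) ^ l)) p ρ := by
    intro k l
    refine ContinuousOn.circleIntegrable hρ.le ?_
    refine continuousOn_const.div (by fun_prop) fun w hw => ?_
    exact mul_ne_zero (pow_ne_zero _ (hw0 w hw))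
      (pow_ne_zero _ (hw1 w (Metric.sphere_subset_closedBall hw)))
  have key : ∀ m : ℕ, ∮ w in C(p, ρ), 1 / ((w - p) ^ (m + 1) * (q - w)) =
      1 / (q - p) * ((∮ w in C(p, ρ), 1 / (w - p) ^ (m + 1)) +
        ∮ w in C(p, ρ), 1 / ((w - p) ^ m * (q - w))) := by
    intro m
    have e1 := hci (m + 1) 0
    have e2 := hci m 1
    simp only [pow_zero, mul_one, pow_one] at e1 e2
    rw [← circleIntegral.integral_add e1 e2, ← circleIntegral.integral_const_mul]
    refine circleIntegral.integral_congr hρ.le fun w hw => ?_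
    have := hw0 w hw
    have := hw1 w (Metric.sphere_subset_closedBall hw)
    field_simp
    ring
  induction m with
  | zero =>
    rw [key 0]
    simp only [zero_add, pow_one, pow_zero, one_mul, hanal]
    simp only [one_div]
    rw [circleIntegral.integral_sub_center_inv p hρ.ne']
    field_simp
    simp
  | succ m ih =>
    rw [key (m + 1), ih]
    have : ∮ w in C(p, ρ), 1 / (w - p) ^ (m + 1 + 1) = 0 := by
      have := circleIntegral.integral_sub_zpow_of_ne (n := -((m : ℤ) + 2)) (by omega) p p ρ
      rw [← this]
      refine circleIntegral.integral_congr hρ.le fun w hw => ?_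
      simp only [zpow_neg, one_div]
      norm_cast
    rw [this]
    field_simp
    ring

/-- Cauchy's formula outside the circle: a rational function of `w` with its only pole at `1` and
vanishing at infinity is reproduced at exterior points. -/
theorem circleIntegral_one_pow_div {ρ : ℝ} (hρ : 0 < ρ) {q : ℂ} (hq : q ∉ Metric.closedBall 1 ρ)
    {a c : ℕ} (hac : a < c) :
    ∮ w in C(1, ρ), w ^ a / ((w - 1) ^ c * (q - w)) = 2 * Real.pi * I * (q ^ a / (q - 1) ^ c) := by
  have hpq : q - 1 ≠ 0 := by
    intro h; apply hq; rw [sub_eq_zero.1 h]; simp [hρ.le]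
  induction a generalizing c with
  | zero =>
    obtain ⟨m, rfl⟩ : ∃ m, c = m + 1 := ⟨c - 1, by omega⟩
    simp only [pow_zero]
    rw [circleIntegral_sub_inv_pow_div hρ hq]
    ring
  | succ a ih =>
    obtain ⟨c, rfl⟩ : ∃ m, c = m + 1 := ⟨c - 1, by omega⟩
    have hw0 : ∀ w ∈ Metric.sphere (1 : ℂ) ρ, w - 1 ≠ 0 := fun w hw => sub_ne_zero_of_mem hρ hw
    have hw1 : ∀ w ∈ Metric.sphere (1 : ℂ) ρ, q - w ≠ 0 := fun w hw => sub_ne_zero_of_notMem hq hw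
    have hci : ∀ k l : ℕ, CircleIntegrable (fun w => w ^ k / ((w - 1) ^ l * (q - w))) 1 ρ := by
      intro k l
      refine ContinuousOn.circleIntegrable hρ.le ?_
      refine ContinuousOn.div (by fun_prop) (by fun_prop) fun w hw => ?_
      exact mul_ne_zero (pow_ne_zero _ (hw0 w hw)) (hw1 w hw)
    -- One factor of the numerator is written as `w = (w - 1) + 1`.
    have : ∮ w in C(1, ρ), w ^ (a + 1) / ((w - 1) ^ (c + 1) * (q - w)) =
        (∮ w in C(1, ρ), w ^ a / ((w - 1) ^ c * (q - w))) +
          ∮ w in C(1, ρ), w ^ a / ((w - 1) ^ (c + 1) * (q - w)) := by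
      rw [← circleIntegral.integral_add (hci _ _) (hci _ _)]
      refine circleIntegral.integral_congr hρ.le fun w hw => ?_
      have := hw0 w hw
      have := hw1 w hw
      field_simp
      ring
    rw [this, ih (by omega), ih (by omega)]
    field_simp
    ring

/-- The same for a function with the value `1` at infinity. -/
theorem circleIntegral_one_pow_div_self {ρ : ℝ} (hρ : 0 < ρ) {q : ℂ}
    (hq : q ∉ Metric.closedBall 1 ρ) (a : ℕ) :
    ∮ w in C(1, ρ), w ^ a / ((w - 1) ^ a * (q - w)) =
      2 * Real.pi * I * (q ^ a / (q - 1) ^ a - 1) := by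
  have hpq : q - 1 ≠ 0 := by
    intro h; apply hq; rw [sub_eq_zero.1 h]; simp [hρ.le]
  have hw0 : ∀ w ∈ Metric.sphere (1 : ℂ) ρ, w - 1 ≠ 0 := fun w hw => sub_ne_zero_of_mem hρ hw
  have hw1 : ∀ w ∈ Metric.closedBall (1 : ℂ) ρ, q - w ≠ 0 := by
    intro w hw h
    rw [sub_eq_zero.1 h] at hq
    exact hq hw
  induction a with
  | zero =>
    simp only [pow_zero, one_mul, div_one, sub_self, mul_zero]
    refine circleIntegral_eq_zero_of_differentiable_on_off_countable hρ.le countable_empty ?_ ?_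
    · exact continuousOn_const.div (by fun_prop) hw1
    · intro w hw
      exact (differentiableAt_const _).div (by fun_prop)
        (hw1 w (Metric.ball_subset_closedBall hw.1))
  | succ a ih =>
    have hci : ∀ k l : ℕ, CircleIntegrable (fun w => w ^ k / ((w - 1) ^ l * (q - w))) 1 ρ := by
      intro k l
      refine ContinuousOn.circleIntegrable hρ.le ?_
      refine ContinuousOn.div (by fun_prop) (by fun_prop) fun w hw => ?_
      exact mul_ne_zero (pow_ne_zero _ (hw0 w hw)) (hw1 w (Metric.sphere_subset_closedBall hw))
    have : ∮ w in C(1, ρ), w ^ (a + 1) / ((w - 1) ^ (a + 1) * (q - w)) =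
        (∮ w in C(1, ρ), w ^ a / ((w - 1) ^ a * (q - w))) +
          ∮ w in C(1, ρ), w ^ a / ((w - 1) ^ (a + 1) * (q - w)) := by
      rw [← circleIntegral.integral_add (hci _ _) (hci _ _)]
      refine circleIntegral.integral_congr hρ.le fun w hw => ?_
      have := hw0 w hw
      have := hw1 w (Metric.sphere_subset_closedBall hw)
      field_simp
      ring
    rw [this, ih, circleIntegral_one_pow_div hρ hq (show a < a + 1 by omega)]
    field_simp
    ring

/-- The analogue of `circleIntegral_one_pow_div` for a pole at `0`. -/
theorem circleIntegral_zero_pow_div {ρ : ℝ} (hρ : 0 < ρ) {q : ℂ} (hq : q ∉ Metric.closedBall 0 ρ)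
    {a b c : ℕ} (habc : b + c < a) :
    ∮ z in C(0, ρ), (z + 1) ^ b * (z - 1) ^ c / (z ^ a * (q - z)) =
      2 * Real.pi * I * ((q + 1) ^ b * (q - 1) ^ c / q ^ a) := by
  have hpq : q ≠ 0 := by
    rintro rfl; apply hq; simp [hρ.le]
  have hz0 : ∀ z ∈ Metric.sphere (0 : ℂ) ρ, z ≠ 0 := fun z hz => by
    simpa using sub_ne_zero_of_mem hρ hz
  have hz1 : ∀ z ∈ Metric.sphere (0 : ℂ) ρ, q - z ≠ 0 := fun z hz => sub_ne_zero_of_notMem hq hz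
  have hci : ∀ k l m : ℕ,
      CircleIntegrable (fun z => (z + 1) ^ k * (z - 1) ^ l / (z ^ m * (q - z))) 0 ρ := by
    intro k l m
    refine ContinuousOn.circleIntegrable hρ.le ?_
    refine ContinuousOn.div (by fun_prop) (by fun_prop) fun z hz => ?_
    exact mul_ne_zero (pow_ne_zero _ (hz0 z hz)) (hz1 z hz)
  induction b generalizing a with
  | zero =>
    simp only [pow_zero, one_mul]
    simp only [zero_add] at habc
    induction c generalizing a with
    | zero =>
      obtain ⟨m, rfl⟩ : ∃ m, a = m + 1 := ⟨a - 1, by omega⟩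
      have := circleIntegral_sub_inv_pow_div hρ hq m
      simp only [sub_zero] at this
      simp only [pow_zero]
      rw [this]
      ring
    | succ c ih =>
      obtain ⟨a, rfl⟩ : ∃ m, a = m + 1 := ⟨a - 1, by omega⟩
      have : ∮ z in C(0, ρ), (z - 1) ^ (c + 1) / (z ^ (a + 1) * (q - z)) =
          (∮ z in C(0, ρ), (z - 1) ^ c / (z ^ a * (q - z))) -
            ∮ z in C(0, ρ), (z - 1) ^ c / (z ^ (a + 1) * (q - z)) := by
        have h1 := hci 0 c a
        have h2 := hci 0 c (a + 1)
        simp only [pow_zero, one_mul] at h1 h2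
        rw [← circleIntegral.integral_sub h1 h2]
        refine circleIntegral.integral_congr hρ.le fun z hz => ?_
        have := hz0 z hz
        have := hz1 z hz
        field_simp
        ring
      rw [this, ih (by omega), ih (by omega)]
      field_simp
      ring
  | succ b ih =>
    obtain ⟨a, rfl⟩ : ∃ m, a = m + 1 := ⟨a - 1, by omega⟩
    have : ∮ z in C(0, ρ), (z + 1) ^ (b + 1) * (z - 1) ^ c / (z ^ (a + 1) * (q - z)) =
        (∮ z in C(0, ρ), (z + 1) ^ b * (z - 1) ^ c / (z ^ a * (q - z))) +
          ∮ z in C(0, ρ), (z + 1) ^ b * (z - 1) ^ c / (z ^ (a + 1) * (q - z)) := by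
      rw [← circleIntegral.integral_add (hci _ _ _) (hci _ _ _)]
      refine circleIntegral.integral_congr hρ.le fun z hz => ?_
      have := hz0 z hz
      have := hz1 z hz
      field_simp
      ring
    rw [this, ih (by omega), ih (by omega)]
    field_simp
    ring

/-- The quotient has its only pole at `0`, so its residue there is its coefficient of `1 / z` at
infinity. -/
theorem circleIntegral_zero_pow_div_succ {ρ : ℝ} (hρ : 0 < ρ) {a m : ℕ} (ham : a ≤ m) :
    ∮ z in C(0, ρ), (z - 1) ^ a / z ^ (m + 1) = if a = m then 2 * Real.pi * I else 0 := by
  have hz0 : ∀ z ∈ Metric.sphere (0 : ℂ) ρ, z ≠ 0 := fun z hz => by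
    simpa using sub_ne_zero_of_mem hρ hz
  have hci : ∀ k l : ℕ, CircleIntegrable (fun z => (z - 1) ^ k / z ^ l) 0 ρ := by
    intro k l
    refine ContinuousOn.circleIntegrable hρ.le ?_
    exact ContinuousOn.div (by fun_prop) (by fun_prop) fun z hz => pow_ne_zero _ (hz0 z hz)
  induction a generalizing m with
  | zero =>
    split_ifs with h
    · subst h
      simpa using circleIntegral.integral_sub_center_inv (0 : ℂ) hρ.ne'
    · have := circleIntegral.integral_sub_zpow_of_ne (n := -((m : ℤ) + 1)) (by omega) (0 : ℂ) 0 ρ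
      refine Eq.trans ?_ this
      refine circleIntegral.integral_congr hρ.le fun w hw => ?_
      simp only [zpow_neg, one_div, pow_zero, sub_zero]
      norm_cast
  | succ a ih =>
    obtain ⟨m, rfl⟩ : ∃ k, m = k + 1 := ⟨m - 1, by omega⟩
    have : ∮ z in C(0, ρ), (z - 1) ^ (a + 1) / z ^ (m + 1 + 1) =
        (∮ z in C(0, ρ), (z - 1) ^ a / z ^ (m + 1)) -
          ∮ z in C(0, ρ), (z - 1) ^ a / z ^ (m + 1 + 1) := by
      rw [← circleIntegral.integral_sub (hci _ _) (hci _ _)]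
      refine circleIntegral.integral_congr hρ.le fun z hz => ?_
      have := hz0 z hz
      field_simp
      ring
    rw [this, ih (by omega), ih (by omega), if_neg (show a ≠ m + 1 by omega)]
    simp

theorem circleIntegral_eq_zero_of_differentiableAt {ρ : ℝ} (hρ : 0 < ρ) {p : ℂ} {f : ℂ → ℂ}
    (hf : ∀ z ∈ Metric.closedBall p ρ, DifferentiableAt ℂ f z) : ∮ z in C(p, ρ), f z = 0 :=
  circleIntegral_eq_zero_of_differentiable_on_off_countable hρ.le countable_empty
    (fun z hz => (hf z hz).continuousAt.continuousWithinAt)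
    fun z hz => hf z (Metric.ball_subset_closedBall hz.1)

theorem circleIntegral_div_sub_center {ρ : ℝ} (hρ : 0 < ρ) {p : ℂ} {f : ℂ → ℂ}
    (hf : ∀ z ∈ Metric.closedBall p ρ, DifferentiableAt ℂ f z) :
    ∮ z in C(p, ρ), f z / (z - p) = 2 * Real.pi * I * f p := by
  have := circleIntegral_sub_inv_smul_of_differentiable_on_off_countable (s := ∅) (f := f)
    countable_empty (Metric.mem_ball_self (x := p) hρ)
    (fun z hz => (hf z hz).continuousAt.continuousWithinAt)
    fun z hz => hf z (Metric.ball_subset_closedBall hz.1)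
  simp only [smul_eq_mul] at this
  rw [← this]
  simp only [div_eq_mul_inv, mul_comm]

/-! ### The two contours -/

/-- The two radii are positive and less than `1 / 2`, so that the closed discs are disjoint and
contain only the poles `0` and `1`, respectively. -/
structure SmallRadii (ρ₁ ρ₂ : ℝ) : Prop where
  pos₁ : 0 < ρ₁
  lt₁ : ρ₁ < 1 / 2
  pos₂ : 0 < ρ₂
  lt₂ : ρ₂ < 1 / 2

section
variable {ρ₁ ρ₂ : ℝ} (hρ : SmallRadii ρ₁ ρ₂) {z w : ℂ}
include hρ

theorem SmallRadii.z_ne (hz : z ∈ Metric.sphere (0 : ℂ) ρ₁) : z ≠ 0 := by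
  simpa using sub_ne_zero_of_mem hρ.pos₁ hz

theorem SmallRadii.w_sub_one_ne (hw : w ∈ Metric.sphere (1 : ℂ) ρ₂) : w - 1 ≠ 0 :=
  sub_ne_zero_of_mem hρ.pos₂ hw

theorem SmallRadii.z_add_one_ne (hz : z ∈ Metric.closedBall (0 : ℂ) ρ₁) : z + 1 ≠ 0 := by
  intro h
  rw [eq_neg_of_add_eq_zero_left h] at hz
  have := hρ.lt₁
  simp at hz
  linarith

theorem SmallRadii.z_sub_one_ne (hz : z ∈ Metric.closedBall (0 : ℂ) ρ₁) : z - 1 ≠ 0 := by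
  intro h
  rw [sub_eq_zero.1 h] at hz
  have := hρ.lt₁
  simp at hz
  linarith

theorem SmallRadii.w_ne (hw : w ∈ Metric.closedBall (1 : ℂ) ρ₂) : w ≠ 0 := by
  rintro rfl
  have := hρ.lt₂
  simp at hw
  linarith

theorem SmallRadii.w_add_one_ne (hw : w ∈ Metric.closedBall (1 : ℂ) ρ₂) : w + 1 ≠ 0 := by
  intro h
  rw [eq_neg_of_add_eq_zero_left h, mem_closedBall_iff_norm] at hw
  have := hρ.lt₂
  norm_num at hw
  linarith

theorem SmallRadii.z_sub_w_ne (hz : z ∈ Metric.closedBall (0 : ℂ) ρ₁)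
    (hw : w ∈ Metric.closedBall (1 : ℂ) ρ₂) : z - w ≠ 0 := by
  intro h
  rw [sub_eq_zero.1 h] at hz
  have h1 := hρ.lt₁
  have h2 := hρ.lt₂
  have h3 := dist_triangle (0 : ℂ) w 1
  rw [dist_comm 0 w] at h3
  rw [Metric.mem_closedBall] at hz hw
  simp only [dist_zero_left, norm_one] at h3
  linarith

end

/-- All the factors that occur in denominators are nonzero on the contours. -/
theorem SmallRadii.ne {ρ₁ ρ₂ : ℝ} (hρ : SmallRadii ρ₁ ρ₂) {z w : ℂ}
    (hz : z ∈ Metric.sphere (0 : ℂ) ρ₁) (hw : w ∈ Metric.sphere (1 : ℂ) ρ₂) :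
    z ≠ 0 ∧ z + 1 ≠ 0 ∧ z - 1 ≠ 0 ∧ w ≠ 0 ∧ w + 1 ≠ 0 ∧ w - 1 ≠ 0 ∧ z - w ≠ 0 ∧ w - z ≠ 0 :=
  have hz' := Metric.sphere_subset_closedBall hz
  have hw' := Metric.sphere_subset_closedBall hw
  ⟨hρ.z_ne hz, hρ.z_add_one_ne hz', hρ.z_sub_one_ne hz', hρ.w_ne hw', hρ.w_add_one_ne hw',
    hρ.w_sub_one_ne hw, hρ.z_sub_w_ne hz' hw', fun h => hρ.z_sub_w_ne hz' hw' (by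
      rw [← neg_sub, h, neg_zero])⟩

/-- The kernel of the double contour integral of exponents `a, b, c`:
`wᵃ (w + 1)⁻ᵇ (w - 1)⁻ᶜ` over the same expression in `z`, over `z - w`. -/
def towerKernel (a b c : ℕ) (z w : ℂ) : ℂ :=
  w ^ a * ((z + 1) ^ b * (z - 1) ^ c) / (z ^ a * ((w + 1) ^ b * (w - 1) ^ c) * (z - w))

/-- The double contour integral of `g` against the kernel of exponents `a, b, c`. -/
def moment (ρ₁ ρ₂ : ℝ) (a b c : ℕ) (g : ℂ → ℂ → ℂ) : ℂ :=
  doubleContour ρ₁ ρ₂ (fun z w => towerKernel a b c z w * g z w)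

section
variable {ρ₁ ρ₂ : ℝ} {a b c : ℕ} {g : ℂ → ℂ → ℂ}

theorem towerKernel_mul_continuous (hρ : SmallRadii ρ₁ ρ₂) (a b c : ℕ)
    (hg : ContourContinuous ρ₁ ρ₂ g) :
    ContourContinuous ρ₁ ρ₂ (fun z w => towerKernel a b c z w * g z w) := by
  refine ContinuousOn.mul ?_ hg
  unfold towerKernel
  refine ContinuousOn.div (by fun_prop) (by fun_prop) ?_
  rintro ⟨z, w⟩ ⟨hz, hw⟩
  obtain ⟨h1, h2, h3, h4, h5, h6, h7, h8⟩ := hρ.ne hz hw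
  simp_all

theorem moment_eq_zero_of_left (hρ : SmallRadii ρ₁ ρ₂)
    (hg : ∀ w ∈ Metric.sphere (1 : ℂ) ρ₂, ∀ z ∈ Metric.closedBall (0 : ℂ) ρ₁,
      DifferentiableAt ℂ (fun z => g z w) z) : moment ρ₁ ρ₂ 0 b c g = 0 := by
  unfold moment doubleContour
  have : ∀ w ∈ Metric.sphere (1 : ℂ) ρ₂, ∮ z in C(0, ρ₁), towerKernel 0 b c z w * g z w = 0 := by
    intro w hw
    refine circleIntegral_eq_zero_of_differentiableAt hρ.pos₁ fun z hz => ?_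
    refine DifferentiableAt.mul ?_ (hg w hw z hz)
    unfold towerKernel
    refine DifferentiableAt.div (by fun_prop) (by fun_prop) ?_
    have hw' := Metric.sphere_subset_closedBall hw
    have h1 := hρ.w_ne hw'
    have h2 := hρ.w_add_one_ne hw'
    have h3 := hρ.w_sub_one_ne hw
    have h4 := hρ.z_sub_w_ne hz hw'
    simp_all
  rw [circleIntegral.integral_congr hρ.pos₂.le (g := fun _ => 0) (fun w hw => this w hw)]
  simp [circleIntegral]

theorem moment_eq_zero_of_right (hρ : SmallRadii ρ₁ ρ₂) (hgc : ContourContinuous ρ₁ ρ₂ g)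
    (hg : ∀ z ∈ Metric.sphere (0 : ℂ) ρ₁, ∀ w ∈ Metric.closedBall (1 : ℂ) ρ₂,
      DifferentiableAt ℂ (fun w => g z w) w) : moment ρ₁ ρ₂ a b 0 g = 0 := by
  unfold moment
  rw [doubleContour_swap hρ.pos₁.le hρ.pos₂.le (towerKernel_mul_continuous hρ a b 0 hgc)]
  have : ∀ z ∈ Metric.sphere (0 : ℂ) ρ₁, ∮ w in C(1, ρ₂), towerKernel a b 0 z w * g z w = 0 := by
    intro z hz
    refine circleIntegral_eq_zero_of_differentiableAt hρ.pos₂ fun w hw => ?_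
    refine DifferentiableAt.mul ?_ (hg z hz w hw)
    unfold towerKernel
    refine DifferentiableAt.div (by fun_prop) (by fun_prop) ?_
    have hz' := Metric.sphere_subset_closedBall hz
    have h1 := hρ.z_ne hz
    have h2 := hρ.w_add_one_ne hw
    have h4 := hρ.z_sub_w_ne hz' hw
    simp_all
  rw [circleIntegral.integral_congr hρ.pos₁.le (g := fun _ => 0) (fun z hz => this z hz)]
  simp [circleIntegral]

/-- Evaluation of the integral over `w` by the pole at `z`, when there is no pole at infinity. -/
theorem doubleContour_eval_right (hρ : SmallRadii ρ₁ ρ₂) {a c : ℕ} (hac : a < c) {φ : ℂ → ℂ}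
    (hφ : ContinuousOn φ (Metric.sphere 0 ρ₁)) :
    doubleContour ρ₁ ρ₂ (fun z w => w ^ a / ((w - 1) ^ c * (z - w)) * φ z) =
      1 / (2 * Real.pi * I) * ∮ z in C(0, ρ₁), z ^ a / (z - 1) ^ c * φ z := by
  rw [doubleContour_swap hρ.pos₁.le hρ.pos₂.le]
  · have : ∀ z ∈ Metric.sphere (0 : ℂ) ρ₁,
        ∮ w in C(1, ρ₂), w ^ a / ((w - 1) ^ c * (z - w)) * φ z =
          2 * Real.pi * I * (z ^ a / (z - 1) ^ c * φ z) := by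
      intro z hz
      have := circleIntegral_one_pow_div hρ.pos₂ (q := z)
        (fun h => hρ.z_sub_w_ne (Metric.sphere_subset_closedBall hz) h (sub_self z)) hac
      simp only [mul_comm _ (φ z)]
      rw [circleIntegral.integral_const_mul, this]
      ring
    rw [circleIntegral.integral_congr hρ.pos₁.le fun z hz => this z hz,
      circleIntegral.integral_const_mul]
    have := two_pi_I_ne_zero
    field_simp
  · refine ContinuousOn.mul (ContinuousOn.div (by fun_prop) (by fun_prop) ?_) ?_
    · rintro ⟨z, w⟩ ⟨hz, hw⟩
      obtain ⟨h1, h2, h3, h4, h5, h6, h7, h8⟩ := hρ.ne hz hw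
      simp_all
    · exact hφ.comp (by fun_prop) fun p hp => hp.1

/-- The same when the function of `w` has the value `1` at infinity. -/
theorem doubleContour_eval_right_self (hρ : SmallRadii ρ₁ ρ₂) (a : ℕ) {φ : ℂ → ℂ}
    (hφ : ContinuousOn φ (Metric.sphere 0 ρ₁)) :
    doubleContour ρ₁ ρ₂ (fun z w => w ^ a / ((w - 1) ^ a * (z - w)) * φ z) =
      1 / (2 * Real.pi * I) * ∮ z in C(0, ρ₁), (z ^ a / (z - 1) ^ a - 1) * φ z := by
  rw [doubleContour_swap hρ.pos₁.le hρ.pos₂.le]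
  · have : ∀ z ∈ Metric.sphere (0 : ℂ) ρ₁,
        ∮ w in C(1, ρ₂), w ^ a / ((w - 1) ^ a * (z - w)) * φ z =
          2 * Real.pi * I * ((z ^ a / (z - 1) ^ a - 1) * φ z) := by
      intro z hz
      have := circleIntegral_one_pow_div_self hρ.pos₂ (q := z)
        (fun h => hρ.z_sub_w_ne (Metric.sphere_subset_closedBall hz) h (sub_self z)) a
      simp only [mul_comm _ (φ z)]
      rw [circleIntegral.integral_const_mul, this]
      ring
    rw [circleIntegral.integral_congr hρ.pos₁.le fun z hz => this z hz,
      circleIntegral.integral_const_mul]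
    have := two_pi_I_ne_zero
    field_simp
  · refine ContinuousOn.mul (ContinuousOn.div (by fun_prop) (by fun_prop) ?_) ?_
    · rintro ⟨z, w⟩ ⟨hz, hw⟩
      obtain ⟨h1, h2, h3, h4, h5, h6, h7, h8⟩ := hρ.ne hz hw
      simp_all
    · exact hφ.comp (by fun_prop) fun p hp => hp.1

/-- Evaluation of the integral over `z` by the pole at `w`, when there is no pole at infinity. -/
theorem doubleContour_eval_left (hρ : SmallRadii ρ₁ ρ₂) {a b c : ℕ} (habc : b + c < a) (ψ : ℂ → ℂ) :
    doubleContour ρ₁ ρ₂ (fun z w => (z + 1) ^ b * (z - 1) ^ c / (z ^ a * (w - z)) * ψ w) =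
      1 / (2 * Real.pi * I) * ∮ w in C(1, ρ₂), (w + 1) ^ b * (w - 1) ^ c / w ^ a * ψ w := by
  unfold doubleContour
  have : ∀ w ∈ Metric.sphere (1 : ℂ) ρ₂,
      ∮ z in C(0, ρ₁), (z + 1) ^ b * (z - 1) ^ c / (z ^ a * (w - z)) * ψ w =
        2 * Real.pi * I * ((w + 1) ^ b * (w - 1) ^ c / w ^ a * ψ w) := by
    intro w hw
    have := circleIntegral_zero_pow_div hρ.pos₁ (q := w)
      (fun h => hρ.z_sub_w_ne h (Metric.sphere_subset_closedBall hw) (sub_self w)) habc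
    simp only [mul_comm _ (ψ w)]
    rw [circleIntegral.integral_const_mul, this]
    ring
  rw [circleIntegral.integral_congr hρ.pos₂.le fun w hw => this w hw,
    circleIntegral.integral_const_mul]
  have := two_pi_I_ne_zero
  field_simp

end

/-! ### Boundary values of the contour integrals -/

theorem ContourContinuous.const_mul {ρ₁ ρ₂ : ℝ} {g : ℂ → ℂ → ℂ} (hg : ContourContinuous ρ₁ ρ₂ g)
    (a : ℂ) : ContourContinuous ρ₁ ρ₂ (fun z w => a * g z w) :=
  ContinuousOn.mul continuousOn_const hg

section
variable {ρ₁ ρ₂ : ℝ} (hρ : SmallRadii ρ₁ ρ₂)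
include hρ

theorem SmallRadii.contourContinuous_div {p q : ℂ → ℂ → ℂ}
    (hp : Continuous fun x : ℂ × ℂ => p x.1 x.2) (hq : Continuous fun x : ℂ × ℂ => q x.1 x.2)
    (hne : ∀ z w : ℂ, z ≠ 0 → z + 1 ≠ 0 → z - 1 ≠ 0 → w ≠ 0 → w + 1 ≠ 0 → w - 1 ≠ 0 → z - w ≠ 0 →
      q z w ≠ 0) : ContourContinuous ρ₁ ρ₂ (fun z w => p z w / q z w) := by
  refine ContinuousOn.div hp.continuousOn hq.continuousOn ?_
  rintro ⟨z, w⟩ ⟨hz, hw⟩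
  obtain ⟨h1, h2, h3, h4, h5, h6, h7, -⟩ := hρ.ne hz hw
  exact hne z w h1 h2 h3 h4 h5 h6 h7

theorem contourContinuous_east : ContourContinuous ρ₁ ρ₂ (fun z _ => 1 / (1 + z)) :=
  hρ.contourContinuous_div (by fun_prop) (by fun_prop) (by intros; rwa [add_comm])

theorem contourContinuous_north : ContourContinuous ρ₁ ρ₂ (fun z _ => 1 / (z - 1)) :=
  hρ.contourContinuous_div (by fun_prop) (by fun_prop) (by intros; assumption)

theorem contourContinuous_west : ContourContinuous ρ₁ ρ₂ (fun z w => 1 / (w * (z - 1))) :=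
  hρ.contourContinuous_div (by fun_prop) (by fun_prop) (by intros; exact mul_ne_zero ‹_› ‹_›)

theorem contourContinuous_south : ContourContinuous ρ₁ ρ₂ (fun z w => 1 / (w * (1 + z))) :=
  hρ.contourContinuous_div (by fun_prop) (by fun_prop)
    (by intros; rw [add_comm]; exact mul_ne_zero ‹_› ‹_›)

theorem contourContinuous_GT : ContourContinuous ρ₁ ρ₂ GT :=
  hρ.contourContinuous_div (by fun_prop) (by fun_prop)
    (by intros; exact mul_ne_zero (mul_ne_zero ‹_› ‹_›) ‹_›)

theorem moment_east_left (b c : ℕ) : moment ρ₁ ρ₂ 0 b c (fun z _ => 1 / (1 + z)) = 0 := by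
  refine moment_eq_zero_of_left hρ fun w _ z hz => ?_
  have := hρ.z_add_one_ne hz
  exact DifferentiableAt.div (by fun_prop) (by fun_prop) (by rwa [add_comm])

theorem moment_east_right (a b : ℕ) : moment ρ₁ ρ₂ a b 0 (fun z _ => 1 / (1 + z)) = 0 :=
  moment_eq_zero_of_right hρ (contourContinuous_east hρ) fun z _ w _ => by fun_prop

theorem moment_north_left (b c : ℕ) : moment ρ₁ ρ₂ 0 b c (fun z _ => 1 / (z - 1)) = 0 := by
  refine moment_eq_zero_of_left hρ fun w _ z hz => ?_
  have := hρ.z_sub_one_ne hz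
  exact DifferentiableAt.div (by fun_prop) (by fun_prop) this

theorem moment_south_right (a b : ℕ) : moment ρ₁ ρ₂ a b 0 (fun z w => 1 / (w * (1 + z))) = 0 := by
  refine moment_eq_zero_of_right hρ (contourContinuous_south hρ) fun z hz w hw => ?_
  have h1 := hρ.z_add_one_ne (Metric.sphere_subset_closedBall hz)
  have h2 := hρ.w_ne hw
  rw [add_comm] at h1
  exact DifferentiableAt.div (by fun_prop) (by fun_prop) (mul_ne_zero h2 h1)

theorem moment_GT_left (b c : ℕ) : moment ρ₁ ρ₂ 0 b c GT = 0 := by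
  refine moment_eq_zero_of_left hρ fun w hw z hz => ?_
  unfold GT
  exact DifferentiableAt.div (by fun_prop) (by fun_prop) (mul_ne_zero
    (mul_ne_zero (hρ.z_sub_one_ne hz) (hρ.z_add_one_ne hz))
    (hρ.w_ne (Metric.sphere_subset_closedBall hw)))

theorem moment_GT_right (a b : ℕ) : moment ρ₁ ρ₂ a b 0 GT = 0 := by
  refine moment_eq_zero_of_right hρ (contourContinuous_GT hρ) fun z hz w hw => ?_
  have hz' := Metric.sphere_subset_closedBall hz
  unfold GT
  exact DifferentiableAt.div (by fun_prop) (by fun_prop) (mul_ne_zero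
    (mul_ne_zero (hρ.z_sub_one_ne hz') (hρ.z_add_one_ne hz')) (hρ.w_ne hw))

theorem moment_north_bottom {a c : ℕ} (hac : a < c) :
    moment ρ₁ ρ₂ a 0 c (fun z _ => 1 / (z - 1)) = 0 := by
  have h := doubleContour_eval_right hρ hac (φ := fun z => (z - 1) ^ c / (z ^ a * (z - 1)))
    (ContinuousOn.div (by fun_prop) (by fun_prop) fun z hz => mul_ne_zero
      (pow_ne_zero _ (hρ.z_ne hz)) (hρ.z_sub_one_ne (Metric.sphere_subset_closedBall hz)))
  unfold moment towerKernel
  rw [doubleContour_congr hρ.pos₁.le hρ.pos₂.le (g' := fun z w =>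
      w ^ a / ((w - 1) ^ c * (z - w)) * ((z - 1) ^ c / (z ^ a * (z - 1)))), h,
    circleIntegral.integral_congr hρ.pos₁.le (g := fun z => 1 / (z - 1)),
    circleIntegral_eq_zero_of_differentiableAt hρ.pos₁, mul_zero]
  · exact fun z hz => DifferentiableAt.div (by fun_prop) (by fun_prop) (hρ.z_sub_one_ne hz)
  · intro z hz
    have h1 := hρ.z_ne hz
    have h2 := hρ.z_sub_one_ne (Metric.sphere_subset_closedBall hz)
    simp only
    field_simp
  · intro z hz w hw
    obtain ⟨h1, h2, h3, h4, h5, h6, h7, -⟩ := hρ.ne hz hw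
    field_simp

theorem moment_south_top {b c : ℕ} (hb : b ≠ 0) :
    moment ρ₁ ρ₂ (b + c) b c (fun z w => 1 / (w * (1 + z))) = 0 := by
  obtain ⟨b, rfl⟩ : ∃ k, b = k + 1 := ⟨b - 1, by omega⟩
  have h := doubleContour_eval_left hρ (show b + c < b + 1 + c by omega)
    (fun w => -(w ^ (b + c)) / ((w + 1) ^ (b + 1) * (w - 1) ^ c))
  unfold moment towerKernel
  rw [doubleContour_congr hρ.pos₁.le hρ.pos₂.le (g' := fun z w =>
      (z + 1) ^ b * (z - 1) ^ c / (z ^ (b + 1 + c) * (w - z)) *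
        (-(w ^ (b + c)) / ((w + 1) ^ (b + 1) * (w - 1) ^ c))), h,
    circleIntegral.integral_congr hρ.pos₂.le (g := fun w => -1 / (w * (w + 1))),
    circleIntegral_eq_zero_of_differentiableAt hρ.pos₂, mul_zero]
  · exact fun w hw => DifferentiableAt.div (by fun_prop) (by fun_prop)
      (mul_ne_zero (hρ.w_ne hw) (hρ.w_add_one_ne hw))
  · intro w hw
    have hw' := Metric.sphere_subset_closedBall hw
    have h1 := hρ.w_ne hw'
    have h2 := hρ.w_add_one_ne hw'
    have h3 := hρ.w_sub_one_ne hw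
    simp only
    field_simp
    ring
  · intro z hz w hw
    obtain ⟨h1, h2, h3, h4, h5, h6, h7, h8⟩ := hρ.ne hz hw
    have h9 : 1 + z ≠ 0 := by rwa [add_comm]
    rw [← neg_sub z w]
    field_simp
    ring

theorem moment_west_bottom {a c : ℕ} (ha : a ≠ 0) (hac : a ≤ c) :
    moment ρ₁ ρ₂ a 0 c (fun z w => 1 / (w * (z - 1))) = -1 := by
  obtain ⟨a, rfl⟩ : ∃ k, a = k + 1 := ⟨a - 1, by omega⟩
  have h := doubleContour_eval_right hρ (show a < c by omega)
    (φ := fun z => (z - 1) ^ c / (z ^ (a + 1) * (z - 1)))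
    (ContinuousOn.div (by fun_prop) (by fun_prop) fun z hz => mul_ne_zero
      (pow_ne_zero _ (hρ.z_ne hz)) (hρ.z_sub_one_ne (Metric.sphere_subset_closedBall hz)))
  unfold moment towerKernel
  rw [doubleContour_congr hρ.pos₁.le hρ.pos₂.le (g' := fun z w =>
      w ^ a / ((w - 1) ^ c * (z - w)) * ((z - 1) ^ c / (z ^ (a + 1) * (z - 1)))), h,
    circleIntegral.integral_congr hρ.pos₁.le (g := fun z => (1 / (z - 1)) / (z - 0)),
    circleIntegral_div_sub_center hρ.pos₁ (f := fun z => 1 / (z - 1))]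
  · have := two_pi_I_ne_zero
    field_simp
    norm_num
  · exact fun z hz => DifferentiableAt.div (by fun_prop) (by fun_prop) (hρ.z_sub_one_ne hz)
  · intro z hz
    have h1 := hρ.z_ne hz
    have h2 := hρ.z_sub_one_ne (Metric.sphere_subset_closedBall hz)
    simp only [sub_zero]
    field_simp
    ring
  · intro z hz w hw
    obtain ⟨h1, h2, h3, h4, h5, h6, h7, -⟩ := hρ.ne hz hw
    field_simp
    ring

theorem moment_west_top {b c : ℕ} (hc : c ≠ 0) :
    moment ρ₁ ρ₂ (b + c) b c (fun z w => 1 / (w * (z - 1))) = -1 := by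
  obtain ⟨c, rfl⟩ : ∃ k, c = k + 1 := ⟨c - 1, by omega⟩
  have h := doubleContour_eval_left hρ (show b + c < b + (c + 1) by omega)
    (fun w => -(w ^ (b + c)) / ((w + 1) ^ b * (w - 1) ^ (c + 1)))
  unfold moment towerKernel
  rw [doubleContour_congr hρ.pos₁.le hρ.pos₂.le (g' := fun z w =>
      (z + 1) ^ b * (z - 1) ^ c / (z ^ (b + (c + 1)) * (w - z)) *
        (-(w ^ (b + c)) / ((w + 1) ^ b * (w - 1) ^ (c + 1)))), h,
    circleIntegral.integral_congr hρ.pos₂.le (g := fun w => (-1 / w) / (w - 1)),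
    circleIntegral_div_sub_center hρ.pos₂ (f := fun w => -1 / w)]
  · have := two_pi_I_ne_zero
    field_simp
  · exact fun w hw => DifferentiableAt.div (by fun_prop) (by fun_prop) (hρ.w_ne hw)
  · intro w hw
    have hw' := Metric.sphere_subset_closedBall hw
    have h1 := hρ.w_ne hw'
    have h2 := hρ.w_add_one_ne hw'
    have h3 := hρ.w_sub_one_ne hw
    simp only
    field_simp
    ring
  · intro z hz w hw
    obtain ⟨h1, h2, h3, h4, h5, h6, h7, h8⟩ := hρ.ne hz hw
    rw [← neg_sub z w]
    field_simp
    ring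

theorem moment_GT_bottom {a c : ℕ} (ha : a ≠ 0) (hac : a < c) :
    moment ρ₁ ρ₂ a 0 c GT = 1 - I := by
  obtain ⟨a, rfl⟩ : ∃ k, a = k + 1 := ⟨a - 1, by omega⟩
  -- The factor `w - I` of the kernel is split into two terms with powers of `w` only.
  set φ : ℂ → ℂ := fun z => (z - 1) ^ c * ((1 - I) * (z - I)) / (z ^ (a + 1) * ((z - 1) * (z + 1)))
  have hφ : ContinuousOn φ (Metric.sphere 0 ρ₁) := by
    refine ContinuousOn.div (by fun_prop) (by fun_prop) fun z hz => ?_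
    have hz' := Metric.sphere_subset_closedBall hz
    exact mul_ne_zero (pow_ne_zero _ (hρ.z_ne hz))
      (mul_ne_zero (hρ.z_sub_one_ne hz') (hρ.z_add_one_ne hz'))
  have h1 := doubleContour_eval_right hρ hac hφ
  have h2 := doubleContour_eval_right hρ (show a < c by omega) hφ
  have hcont : ∀ k : ℕ, ContourContinuous ρ₁ ρ₂
      (fun z w => w ^ k / ((w - 1) ^ c * (z - w)) * φ z) := by
    intro k
    refine ContinuousOn.mul (hρ.contourContinuous_div (p := fun z w => w ^ k)
      (q := fun z w => (w - 1) ^ c * (z - w)) (by fun_prop) (by fun_prop) ?_)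
      (hφ.comp (by fun_prop) fun p hp => hp.1)
    intro z w _ _ _ _ _ h h'
    exact mul_ne_zero (pow_ne_zero _ h) h'
  have hci : ∀ k : ℕ, CircleIntegrable (fun z => z ^ k / (z - 1) ^ c * φ z) 0 ρ₁ := by
    intro k
    refine ContinuousOn.circleIntegrable hρ.pos₁.le (ContinuousOn.mul ?_ hφ)
    exact ContinuousOn.div (by fun_prop) (by fun_prop) fun z hz =>
      pow_ne_zero _ (hρ.z_sub_one_ne (Metric.sphere_subset_closedBall hz))
  have hci' : CircleIntegrable (fun z => -I * (z ^ a / (z - 1) ^ c * φ z)) 0 ρ₁ := 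
    (hci a).const_smul (a := -I)
  unfold moment towerKernel
  rw [doubleContour_congr hρ.pos₁.le hρ.pos₂.le (g' := fun z w =>
      w ^ (a + 1) / ((w - 1) ^ c * (z - w)) * φ z +
        -I * (w ^ a / ((w - 1) ^ c * (z - w)) * φ z)),
    doubleContour_add hρ.pos₁.le hρ.pos₂.le (hcont _)
      ((hcont a).const_mul _), doubleContour_const_mul, h1, h2,
    mul_left_comm, ← mul_add, ← circleIntegral.integral_const_mul,
    ← circleIntegral.integral_add (hci _) hci',
    circleIntegral.integral_congr hρ.pos₁.le
      (g := fun z => ((1 - I) * (z - I) ^ 2 / ((z - 1) * (z + 1))) / (z - 0)),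
    circleIntegral_div_sub_center hρ.pos₁
      (f := fun z => (1 - I) * (z - I) ^ 2 / ((z - 1) * (z + 1)))]
  · have := two_pi_I_ne_zero
    field_simp
    norm_num
  · exact fun z hz => DifferentiableAt.div (by fun_prop) (by fun_prop)
      (mul_ne_zero (hρ.z_sub_one_ne hz) (hρ.z_add_one_ne hz))
  · intro z hz
    have hz' := Metric.sphere_subset_closedBall hz
    have h1 := hρ.z_ne hz
    have h2 := hρ.z_sub_one_ne hz'
    have h3 := hρ.z_add_one_ne hz'
    simp only [sub_zero, φ]
    field_simp
    ring
  · intro z hz w hw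
    obtain ⟨h1, h2, h3, h4, h5, h6, h7, -⟩ := hρ.ne hz hw
    simp only [GT, φ]
    field_simp
    ring

theorem moment_GT_top {b c : ℕ} (hb : b ≠ 0) (hc : c ≠ 0) :
    moment ρ₁ ρ₂ (b + c) b c GT = 1 + I := by
  obtain ⟨b, rfl⟩ : ∃ k, b = k + 1 := ⟨b - 1, by omega⟩
  obtain ⟨c, rfl⟩ : ∃ k, c = k + 1 := ⟨c - 1, by omega⟩
  -- The factor `z - I` of the kernel is split as `(z + 1) - (1 + I)`.
  set ψ : ℂ → ℂ := fun w => -((1 - I) * (w - I) * w ^ (b + 1 + c)) /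
    ((w + 1) ^ (b + 1) * (w - 1) ^ (c + 1))
  have hψ : ContinuousOn ψ (Metric.sphere 1 ρ₂) := by
    refine ContinuousOn.div (by fun_prop) (by fun_prop) fun w hw => ?_
    exact mul_ne_zero (pow_ne_zero _ (hρ.w_add_one_ne (Metric.sphere_subset_closedBall hw)))
      (pow_ne_zero _ (hρ.w_sub_one_ne hw))
  have h1 := doubleContour_eval_left hρ (show b + 1 + c < b + 1 + (c + 1) by omega) ψ
  have h2 := doubleContour_eval_left hρ (show b + c < b + 1 + (c + 1) by omega) ψ
  have hcont : ∀ k : ℕ, ContourContinuous ρ₁ ρ₂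
      (fun z w => (z + 1) ^ k * (z - 1) ^ c / (z ^ (b + 1 + (c + 1)) * (w - z)) * ψ w) := by
    intro k
    refine ContinuousOn.mul (hρ.contourContinuous_div (p := fun z w => (z + 1) ^ k * (z - 1) ^ c)
      (q := fun z w => z ^ (b + 1 + (c + 1)) * (w - z)) (by fun_prop) (by fun_prop) ?_)
      (hψ.comp (by fun_prop) fun p hp => hp.2)
    intro z w h _ _ _ _ _ h'
    exact mul_ne_zero (pow_ne_zero _ h) (by rw [← neg_sub]; exact neg_ne_zero.2 h')
  have hci : ∀ k : ℕ, CircleIntegrable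
      (fun w => (w + 1) ^ k * (w - 1) ^ c / w ^ (b + 1 + (c + 1)) * ψ w) 1 ρ₂ := by
    intro k
    refine ContinuousOn.circleIntegrable hρ.pos₂.le (ContinuousOn.mul ?_ hψ)
    exact ContinuousOn.div (by fun_prop) (by fun_prop) fun w hw =>
      pow_ne_zero _ (hρ.w_ne (Metric.sphere_subset_closedBall hw))
  have hci' : CircleIntegrable
      (fun w => -(1 + I) * ((w + 1) ^ b * (w - 1) ^ c / w ^ (b + 1 + (c + 1)) * ψ w)) 1 ρ₂ := 
    (hci b).const_smul (a := -(1 + I))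
  unfold moment towerKernel
  rw [doubleContour_congr hρ.pos₁.le hρ.pos₂.le (g' := fun z w =>
      (z + 1) ^ (b + 1) * (z - 1) ^ c / (z ^ (b + 1 + (c + 1)) * (w - z)) * ψ w +
        -(1 + I) * ((z + 1) ^ b * (z - 1) ^ c / (z ^ (b + 1 + (c + 1)) * (w - z)) * ψ w)),
    doubleContour_add hρ.pos₁.le hρ.pos₂.le (hcont _)
      ((hcont b).const_mul _), doubleContour_const_mul, h1, h2,
    mul_left_comm, ← mul_add, ← circleIntegral.integral_const_mul,
    ← circleIntegral.integral_add (hci _) hci',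
    circleIntegral.integral_congr hρ.pos₂.le
      (g := fun w => (-((1 - I) * (w - I) ^ 2) / (w * (w + 1))) / (w - 1)),
    circleIntegral_div_sub_center hρ.pos₂
      (f := fun w => -((1 - I) * (w - I) ^ 2) / (w * (w + 1)))]
  · have := two_pi_I_ne_zero
    field_simp
    ring_nf
    simp [I_pow_three]
    ring
  · exact fun w hw => DifferentiableAt.div (by fun_prop) (by fun_prop)
      (mul_ne_zero (hρ.w_ne hw) (hρ.w_add_one_ne hw))
  · intro w hw
    have hw' := Metric.sphere_subset_closedBall hw
    have h1 := hρ.w_ne hw'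
    have h2 := hρ.w_add_one_ne hw'
    have h3 := hρ.w_sub_one_ne hw
    simp only [ψ]
    field_simp
    ring
  · intro z hz w hw
    obtain ⟨h1, h2, h3, h4, h5, h6, h7, h8⟩ := hρ.ne hz hw
    simp only [GT, ψ]
    rw [← neg_sub z w]
    field_simp
    ring

/-- The residue at `0` of an integrand with a further pole at `-1`, which accounts for the power
of `2`. -/
theorem circleIntegral_corner (k : ℕ) :
    ∮ z in C(0, ρ₁), (1 - I) * ((z - 1) ^ k * (z - I)) / (z ^ (k + 1) * (z + 1)) =
      2 * Real.pi * I * (1 - I - 2 ^ (k + 1)) := by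
  have hci : ∀ k l m : ℕ, CircleIntegrable
      (fun z => (1 - I) * ((z - 1) ^ k * (z - I)) / (z ^ l * (z + 1) ^ m)) 0 ρ₁ := by
    intro k l m
    refine ContinuousOn.circleIntegrable hρ.pos₁.le ?_
    refine ContinuousOn.div (by fun_prop) (by fun_prop) fun z hz => mul_ne_zero
      (pow_ne_zero _ (hρ.z_ne hz))
      (pow_ne_zero _ (hρ.z_add_one_ne (Metric.sphere_subset_closedBall hz)))
  have hci' : ∀ k l : ℕ, CircleIntegrable (fun z => (z - 1) ^ k / z ^ l) 0 ρ₁ := by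
    intro k l
    refine ContinuousOn.circleIntegrable hρ.pos₁.le ?_
    exact ContinuousOn.div (by fun_prop) (by fun_prop) fun z hz => pow_ne_zero _ (hρ.z_ne hz)
  induction k with
  | zero =>
    rw [circleIntegral.integral_congr hρ.pos₁.le
      (g := fun z => ((1 - I) * (z - I) / (z + 1)) / (z - 0)),
      circleIntegral_div_sub_center hρ.pos₁ (f := fun z => (1 - I) * (z - I) / (z + 1))]
    · congr 1
      ring_nf
      simp
      ring
    · exact fun z hz => DifferentiableAt.div (by fun_prop) (by fun_prop) (hρ.z_add_one_ne hz)
    · intro z hz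
      have h1 := hρ.z_ne hz
      have h2 := hρ.z_add_one_ne (Metric.sphere_subset_closedBall hz)
      simp only [sub_zero]
      field_simp
      ring
  | succ k ih =>
    have e1 := (hci k (k + 1) 1).const_smul (a := (2 : ℂ))
    have e2 := (hci' (k + 1) (k + 2)).const_smul (a := 1 - I)
    have e3 := (hci' k (k + 2)).const_smul (a := (1 - I) ^ 2)
    have e23 := e2.add e3
    have i2 := circleIntegral_zero_pow_div_succ hρ.pos₁ (le_refl (k + 1))
    have i3 := circleIntegral_zero_pow_div_succ hρ.pos₁ (show k ≤ k + 1 by omega)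
    rw [if_pos rfl] at i2
    rw [if_neg (by omega)] at i3
    -- The factor `(z - 1) / z` between successive integrands, times `1 / (z + 1)`, is
    -- `2 / (z + 1) - 1 / z`.
    have : ∮ z in C(0, ρ₁), (1 - I) * ((z - 1) ^ (k + 1) * (z - I)) / (z ^ (k + 1 + 1) * (z + 1)) =
        (∮ z in C(0, ρ₁), 2 * ((1 - I) * ((z - 1) ^ k * (z - I)) / (z ^ (k + 1) * (z + 1) ^ 1))) -
          ∮ z in C(0, ρ₁), ((1 - I) * ((z - 1) ^ (k + 1) / z ^ (k + 2)) +
            (1 - I) ^ 2 * ((z - 1) ^ k / z ^ (k + 2))) := by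
      refine Eq.trans ?_ (circleIntegral.integral_sub e1 e23)
      refine circleIntegral.integral_congr hρ.pos₁.le fun z hz => ?_
      have h1 := hρ.z_ne hz
      have h2 := hρ.z_add_one_ne (Metric.sphere_subset_closedBall hz)
      simp only [pow_one]
      field_simp
      ring
    rw [this, circleIntegral.integral_const_mul]
    simp only [pow_one]
    rw [ih]
    have h4 : ∮ z in C(0, ρ₁), ((1 - I) * ((z - 1) ^ (k + 1) / z ^ (k + 2)) +
            (1 - I) ^ 2 * ((z - 1) ^ k / z ^ (k + 2))) = (1 - I) * (2 * Real.pi * I) := by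
      refine (circleIntegral.integral_add e2 e3).trans ?_
      simp only [Pi.smul_apply, circleIntegral.integral_smul]
      rw [i2, i3]
      simp
    rw [h4]
    ring

theorem moment_GT_corner {a : ℕ} (ha : a ≠ 0) : moment ρ₁ ρ₂ a 0 a GT = 2 ^ a := by
  obtain ⟨a, rfl⟩ : ∃ k, a = k + 1 := ⟨a - 1, by omega⟩
  set φ : ℂ → ℂ := fun z => (1 - I) * ((z - 1) ^ a * (z - I)) / (z ^ (a + 1) * (z + 1))
  have hφ : ContinuousOn φ (Metric.sphere 0 ρ₁) := by
    refine ContinuousOn.div (by fun_prop) (by fun_prop) fun z hz => ?_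
    exact mul_ne_zero (pow_ne_zero _ (hρ.z_ne hz))
      (hρ.z_add_one_ne (Metric.sphere_subset_closedBall hz))
  have h1 := doubleContour_eval_right_self hρ (a + 1) hφ
  have h2 := doubleContour_eval_right hρ (show a < a + 1 by omega) hφ
  have hcont : ∀ k : ℕ, ContourContinuous ρ₁ ρ₂
      (fun z w => w ^ k / ((w - 1) ^ (a + 1) * (z - w)) * φ z) := by
    intro k
    refine ContinuousOn.mul (hρ.contourContinuous_div (p := fun z w => w ^ k)
      (q := fun z w => (w - 1) ^ (a + 1) * (z - w)) (by fun_prop) (by fun_prop) ?_)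
      (hφ.comp (by fun_prop) fun p hp => hp.1)
    intro z w _ _ _ _ _ h h'
    exact mul_ne_zero (pow_ne_zero _ h) h'
  have hd : ContinuousOn (fun z : ℂ => (z - 1) ^ (a + 1)) (Metric.sphere 0 ρ₁) := by fun_prop
  have hd0 : ∀ z ∈ Metric.sphere (0 : ℂ) ρ₁, (z - 1) ^ (a + 1) ≠ 0 := fun z hz =>
      pow_ne_zero _ (hρ.z_sub_one_ne (Metric.sphere_subset_closedBall hz))
  have hci1 : CircleIntegrable (fun z => (z ^ (a + 1) / (z - 1) ^ (a + 1) - 1) * φ z) 0 ρ₁ :=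
    ContinuousOn.circleIntegrable hρ.pos₁.le (ContinuousOn.mul
      (ContinuousOn.sub (ContinuousOn.div (by fun_prop) hd hd0) continuousOn_const) hφ)
  have hci2 : CircleIntegrable (fun z => -I * (z ^ a / (z - 1) ^ (a + 1) * φ z)) 0 ρ₁ :=
    ContinuousOn.circleIntegrable hρ.pos₁.le (continuousOn_const.mul (ContinuousOn.mul
      (ContinuousOn.div (by fun_prop) hd hd0) hφ))
  have hdiff : ∀ z ∈ Metric.closedBall (0 : ℂ) ρ₁,
      DifferentiableAt ℂ (fun z => (1 - I) * (z - I) ^ 2 / ((z - 1) * (z + 1))) z := fun z hz =>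
    DifferentiableAt.div (by fun_prop) (by fun_prop)
      (mul_ne_zero (hρ.z_sub_one_ne hz) (hρ.z_add_one_ne hz))
  have hci3 : CircleIntegrable
      (fun z => ((1 - I) * (z - I) ^ 2 / ((z - 1) * (z + 1))) / (z - 0)) 0 ρ₁ :=
    ContinuousOn.circleIntegrable hρ.pos₁.le (ContinuousOn.div
      (fun z hz => (hdiff z (Metric.sphere_subset_closedBall hz)).continuousAt.continuousWithinAt)
      (by fun_prop) fun z hz => by simpa using hρ.z_ne hz)
  unfold moment towerKernel
  rw [doubleContour_congr hρ.pos₁.le hρ.pos₂.le (g' := fun z w =>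
      w ^ (a + 1) / ((w - 1) ^ (a + 1) * (z - w)) * φ z +
        -I * (w ^ a / ((w - 1) ^ (a + 1) * (z - w)) * φ z)),
    doubleContour_add hρ.pos₁.le hρ.pos₂.le (hcont _)
      ((hcont a).const_mul _), doubleContour_const_mul, h1, h2,
    mul_left_comm, ← mul_add, ← circleIntegral.integral_const_mul,
    ← circleIntegral.integral_add hci1 hci2,
    circleIntegral.integral_congr hρ.pos₁.le
      (g := fun z => ((1 - I) * (z - I) ^ 2 / ((z - 1) * (z + 1))) / (z - 0) - φ z),
    circleIntegral.integral_sub hci3 (hφ.circleIntegrable hρ.pos₁.le),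
    circleIntegral_div_sub_center hρ.pos₁
      (f := fun z => (1 - I) * (z - I) ^ 2 / ((z - 1) * (z + 1))) hdiff,
    circleIntegral_corner hρ]
  · have := two_pi_I_ne_zero
    field_simp
    norm_num
    ring
  · intro z hz
    have hz' := Metric.sphere_subset_closedBall hz
    have h1 := hρ.z_ne hz
    have h2 := hρ.z_sub_one_ne hz'
    have h3 := hρ.z_add_one_ne hz'
    simp only [sub_zero, φ]
    field_simp
    ring
  · intro z hz w hw
    obtain ⟨h1, h2, h3, h4, h5, h6, h7, -⟩ := hρ.ne hz hw
    simp only [GT, φ]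
    field_simp
    ring

end

/-! ### Recurrences for the contour integrals -/

/-- A linear relation between kernels that holds on the contours passes to the integrals. -/
theorem doubleContour_linear_relation {ρ₁ ρ₂ : ℝ} (h₁ : 0 ≤ ρ₁) (h₂ : 0 ≤ ρ₂) {m : ℕ}
    (c : Fin m → ℂ) (g : Fin m → ℂ → ℂ → ℂ) (hg : ∀ i, ContourContinuous ρ₁ ρ₂ (g i))
    (h : ∀ z ∈ Metric.sphere (0 : ℂ) ρ₁, ∀ w ∈ Metric.sphere (1 : ℂ) ρ₂,
      ∑ i, c i * g i z w = 0) : ∑ i, c i * doubleContour ρ₁ ρ₂ (g i) = 0 := by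
  have hzero : doubleContour ρ₁ ρ₂ (fun _ _ => 0) = 0 := by
    simp [doubleContour, circleIntegral]
  have key : ∀ s : Finset (Fin m),
      ContourContinuous ρ₁ ρ₂ (fun z w => ∑ i ∈ s, c i * g i z w) ∧
      doubleContour ρ₁ ρ₂ (fun z w => ∑ i ∈ s, c i * g i z w) =
        ∑ i ∈ s, c i * doubleContour ρ₁ ρ₂ (g i) := by
    intro s
    induction s using Finset.induction_on with
    | empty =>
      simp only [Finset.sum_empty]
      exact ⟨continuousOn_const, hzero⟩
    | insert i s hi ih =>
      simp only [Finset.sum_insert hi]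
      refine ⟨ContinuousOn.add ((hg i).const_mul (c i)) ih.1, ?_⟩
      rw [doubleContour_add h₁ h₂ ((hg i).const_mul (c i)) ih.1, doubleContour_const_mul, ih.2]
  rw [← (key Finset.univ).2, doubleContour_congr h₁ h₂ h, hzero]

section
variable {ρ₁ ρ₂ : ℝ} (hρ : SmallRadii ρ₁ ρ₂)
include hρ

/-- The discrete wave equation: it holds for the kernel itself, whatever the factor `g`. -/
theorem moment_wave (a b c : ℕ) {g : ℂ → ℂ → ℂ} (hg : ContourContinuous ρ₁ ρ₂ g) :
    moment ρ₁ ρ₂ (a + 1) (b + 1) (c + 1) g =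
      (moment ρ₁ ρ₂ (a + 1) b (c + 1) g + moment ρ₁ ρ₂ a (b + 1) c g +
        moment ρ₁ ρ₂ (a + 1) (b + 1) c g + moment ρ₁ ρ₂ a b (c + 1) g) / 2 -
      moment ρ₁ ρ₂ a b c g := by
  have hK := fun a b c => towerKernel_mul_continuous hρ a b c hg
  have := doubleContour_linear_relation hρ.pos₁.le hρ.pos₂.le
    ![1, 1, -1 / 2, -1 / 2, -1 / 2, -1 / 2]
    ![fun z w => towerKernel (a + 1) (b + 1) (c + 1) z w * g z w,
      fun z w => towerKernel a b c z w * g z w,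
      fun z w => towerKernel (a + 1) b (c + 1) z w * g z w,
      fun z w => towerKernel a (b + 1) c z w * g z w,
      fun z w => towerKernel (a + 1) (b + 1) c z w * g z w,
      fun z w => towerKernel a b (c + 1) z w * g z w]
    (by intro i; fin_cases i <;> exact hK _ _ _)
    (by
      intro z hz w hw
      obtain ⟨h1, h2, h3, h4, h5, h6, h7, -⟩ := hρ.ne hz hw
      simp only [Fin.sum_univ_succ, Matrix.cons_val_zero, Matrix.cons_val_succ, Fin.sum_univ_zero,
        towerKernel]
      field_simp
      ring)
  simp only [Fin.sum_univ_succ, Matrix.cons_val_zero, Matrix.cons_val_succ,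
    Fin.sum_univ_zero] at this
  unfold moment
  linear_combination this

/-- The four kernels for the sides of a face satisfy the recurrence of domino shuffling. Here
`g` is one of the four factors (with its sign), `a', b', c'` are the exponents at the neighbouring
face that shares the side opposite to the one described by `g`, and the hypothesis says that the
difference of the two kernels is half the net creation rate. -/
theorem moment_shuffle (a b c a' b' c' : ℕ) {g : ℂ → ℂ → ℂ} (hg : ContourContinuous ρ₁ ρ₂ g)
    (h : ∀ z w : ℂ, z ≠ 0 → z + 1 ≠ 0 → z - 1 ≠ 0 → w ≠ 0 → w + 1 ≠ 0 → w - 1 ≠ 0 → z - w ≠ 0 →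
      towerKernel (a + 1) (b + 1) (c + 1) z w * g z w - towerKernel a' b' c' z w * g z w =
        towerKernel (a + 1) (b + 1) (c + 1) z w * ((z - w) / (w * (z - 1) * (z + 1)))) :
    moment ρ₁ ρ₂ (a + 1) (b + 1) (c + 1) g =
      moment ρ₁ ρ₂ a' b' c' g -
        (moment ρ₁ ρ₂ a (b + 1) c (fun z _ => 1 / (1 + z)) -
          moment ρ₁ ρ₂ a b (c + 1) (fun z _ => 1 / (z - 1)) +
          moment ρ₁ ρ₂ (a + 1) b (c + 1) (fun z w => 1 / (w * (z - 1))) +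
          moment ρ₁ ρ₂ (a + 1) (b + 1) c (fun z w => 1 / (w * (1 + z)))) / 2 := by
  have := doubleContour_linear_relation hρ.pos₁.le hρ.pos₂.le
    ![1, -1, 1 / 2, -1 / 2, 1 / 2, 1 / 2]
    ![fun z w => towerKernel (a + 1) (b + 1) (c + 1) z w * g z w,
      fun z w => towerKernel a' b' c' z w * g z w,
      fun z w => towerKernel a (b + 1) c z w * (1 / (1 + z)),
      fun z w => towerKernel a b (c + 1) z w * (1 / (z - 1)),
      fun z w => towerKernel (a + 1) b (c + 1) z w * (1 / (w * (z - 1))),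
      fun z w => towerKernel (a + 1) (b + 1) c z w * (1 / (w * (1 + z)))]
    (by
      intro i
      fin_cases i
      · exact towerKernel_mul_continuous hρ _ _ _ hg
      · exact towerKernel_mul_continuous hρ _ _ _ hg
      · exact towerKernel_mul_continuous hρ _ _ _ (contourContinuous_east hρ)
      · exact towerKernel_mul_continuous hρ _ _ _ (contourContinuous_north hρ)
      · exact towerKernel_mul_continuous hρ _ _ _ (contourContinuous_west hρ)
      · exact towerKernel_mul_continuous hρ _ _ _ (contourContinuous_south hρ))
    (by
      intro z hz w hw
      obtain ⟨h1, h2, h3, h4, h5, h6, h7, -⟩ := hρ.ne hz hw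
      have hzw := h z w h1 h2 h3 h4 h5 h6 h7
      simp only [Fin.sum_univ_succ, Matrix.cons_val_zero, Matrix.cons_val_succ, Fin.sum_univ_zero]
      rw [← add_assoc, one_mul, neg_one_mul, ← sub_eq_add_neg, hzw]
      have h9 : 1 + z ≠ 0 := by rwa [add_comm]
      simp only [towerKernel]
      field_simp
      ring)
  simp only [Fin.sum_univ_succ, Matrix.cons_val_zero, Matrix.cons_val_succ,
    Fin.sum_univ_zero] at this
  unfold moment
  linear_combination this

theorem moment_shuffle_east (a b c : ℕ) :
    moment ρ₁ ρ₂ (a + 1) (b + 1) (c + 1) (fun z _ => 1 / (1 + z)) =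
      moment ρ₁ ρ₂ a (b + 1) c (fun z _ => 1 / (1 + z)) -
        (moment ρ₁ ρ₂ a (b + 1) c (fun z _ => 1 / (1 + z)) -
          moment ρ₁ ρ₂ a b (c + 1) (fun z _ => 1 / (z - 1)) +
          moment ρ₁ ρ₂ (a + 1) b (c + 1) (fun z w => 1 / (w * (z - 1))) +
          moment ρ₁ ρ₂ (a + 1) (b + 1) c (fun z w => 1 / (w * (1 + z)))) / 2 := by
  refine moment_shuffle hρ a b c _ _ _ (contourContinuous_east hρ) ?_
  intro z w h1 h2 h3 h4 h5 h6 h7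
  have h9 : 1 + z ≠ 0 := by rwa [add_comm]
  simp only [towerKernel]
  field_simp
  ring

theorem moment_shuffle_north (a b c : ℕ) :
    moment ρ₁ ρ₂ (a + 1) (b + 1) (c + 1) (fun z _ => 1 / (z - 1)) =
      moment ρ₁ ρ₂ a b (c + 1) (fun z _ => 1 / (z - 1)) +
        (moment ρ₁ ρ₂ a (b + 1) c (fun z _ => 1 / (1 + z)) -
          moment ρ₁ ρ₂ a b (c + 1) (fun z _ => 1 / (z - 1)) +
          moment ρ₁ ρ₂ (a + 1) b (c + 1) (fun z w => 1 / (w * (z - 1))) +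
          moment ρ₁ ρ₂ (a + 1) (b + 1) c (fun z w => 1 / (w * (1 + z)))) / 2 := by
  have := moment_shuffle hρ a b c a b (c + 1) ((contourContinuous_north hρ).const_mul (-1)) ?_
  · have hm : ∀ a b c, moment ρ₁ ρ₂ a b c (fun z _ => -1 * (1 / (z - 1))) =
        -moment ρ₁ ρ₂ a b c (fun z _ => 1 / (z - 1)) := by
      intro a b c
      unfold moment
      refine Eq.trans ?_ ((doubleContour_const_mul (-1)).trans (neg_one_mul _))
      congr 1
      ext z w
      ring
    rw [hm, hm] at this
    linear_combination -this
  intro z w h1 h2 h3 h4 h5 h6 h7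
  simp only [towerKernel]
  field_simp
  ring

theorem moment_shuffle_west (a b c : ℕ) :
    moment ρ₁ ρ₂ (a + 1) (b + 1) (c + 1) (fun z w => 1 / (w * (z - 1))) =
      moment ρ₁ ρ₂ (a + 1) b (c + 1) (fun z w => 1 / (w * (z - 1))) -
        (moment ρ₁ ρ₂ a (b + 1) c (fun z _ => 1 / (1 + z)) -
          moment ρ₁ ρ₂ a b (c + 1) (fun z _ => 1 / (z - 1)) +
          moment ρ₁ ρ₂ (a + 1) b (c + 1) (fun z w => 1 / (w * (z - 1))) +
          moment ρ₁ ρ₂ (a + 1) (b + 1) c (fun z w => 1 / (w * (1 + z)))) / 2 := by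
  refine moment_shuffle hρ a b c _ _ _ (contourContinuous_west hρ) ?_
  intro z w h1 h2 h3 h4 h5 h6 h7
  simp only [towerKernel]
  field_simp
  ring

theorem moment_shuffle_south (a b c : ℕ) :
    moment ρ₁ ρ₂ (a + 1) (b + 1) (c + 1) (fun z w => 1 / (w * (1 + z))) =
      moment ρ₁ ρ₂ (a + 1) (b + 1) c (fun z w => 1 / (w * (1 + z))) -
        (moment ρ₁ ρ₂ a (b + 1) c (fun z _ => 1 / (1 + z)) -
          moment ρ₁ ρ₂ a b (c + 1) (fun z _ => 1 / (z - 1)) +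
          moment ρ₁ ρ₂ (a + 1) b (c + 1) (fun z w => 1 / (w * (z - 1))) +
          moment ρ₁ ρ₂ (a + 1) (b + 1) c (fun z w => 1 / (w * (1 + z)))) / 2 := by
  refine moment_shuffle hρ a b c _ _ _ (contourContinuous_south hρ) ?_
  intro z w h1 h2 h3 h4 h5 h6 h7
  have h9 : 1 + z ≠ 0 := by rwa [add_comm]
  simp only [towerKernel]
  field_simp
  ring

end

/-! ### Removal of the logarithms -/

/-- With `2a = r + 1 + j + k`, `2b = r + 1 - j + k`, `2c = r + 1 + j - k`, the exponents of the
integrand are the integers `a, b, c`, whatever the determinations of the logarithms. -/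
theorem contourFormula_eq_moment {f : ℝ → ℝ} {xs : ℝ} {n : ℕ} {H : ℤ → ℤ} {l₀ l₁ l₂ : ℂ → ℂ}
    (hl₀ : IsLogBranch l₀) (hl₁ : IsLogBranch l₁) (hl₂ : IsLogBranch l₂) {ρ₁ ρ₂ : ℝ}
    (hρ : SmallRadii ρ₁ ρ₂) {j k : ℤ} {a b c : ℕ} (ha : 2 * (a : ℤ) = rIndex H j k + 1 + j + k)
    (hb : 2 * (b : ℤ) = rIndex H j k + 1 - j + k) (hc : 2 * (c : ℤ) = rIndex H j k + 1 + j - k)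
    (g : ℂ → ℂ → ℂ) :
    contourFormula f xs n H l₀ l₁ l₂ ρ₁ ρ₂ j k g = moment ρ₁ ρ₂ a b c g := by
  unfold contourFormula moment
  refine doubleContour_congr hρ.pos₁.le hρ.pos₂.le fun z hz w hw => ?_
  obtain ⟨h1, h2, h3, h4, h5, h6, h7, -⟩ := hρ.ne hz hw
  set r : ℕ := rIndex H j k with hr
  have ha' : (a : ℂ) = (r + 1 + j + k) / 2 := by
    have : 2 * (a : ℂ) = r + 1 + j + k := by exact_mod_cast ha
    linear_combination this / 2
  have hb' : (b : ℂ) = (r + 1 - j + k) / 2 := by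
    have : 2 * (b : ℂ) = r + 1 - j + k := by exact_mod_cast hb
    linear_combination this / 2
  have hc' : (c : ℂ) = (r + 1 + j - k) / 2 := by
    have : 2 * (c : ℂ) = r + 1 + j - k := by exact_mod_cast hc
    linear_combination this / 2
  have hn : ((n : ℂ) + 1) ≠ 0 := by exact_mod_cast Nat.succ_ne_zero n
  have key : ((n : ℂ) + 1) *
      (action f xs l₀ l₁ l₂ ((j : ℝ) / ((n : ℝ) + 1)) ((k : ℝ) / ((n : ℝ) + 1)) w
        - action f xs l₀ l₁ l₂ ((j : ℝ) / ((n : ℝ) + 1)) ((k : ℝ) / ((n : ℝ) + 1)) z) +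
      (((eps f xs n H j k + 1) / 2 : ℝ) : ℂ) *
        (l₀ w + l₁ (z + 1) + l₂ (z - 1) - l₀ z - l₁ (w + 1) - l₂ (w - 1)) =
      (a * l₀ w + (b * l₁ (z + 1) + c * l₂ (z - 1))) -
        (a * l₀ z + (b * l₁ (w + 1) + c * l₂ (w - 1))) := by
    simp only [action, eps, ← hr]
    rw [← add_div]
    generalize extend f xs _ = F
    push_cast
    rw [ha', hb', hc']
    field_simp
    ring
  have hexp : exp (((n : ℂ) + 1) *
      (action f xs l₀ l₁ l₂ ((j : ℝ) / ((n : ℝ) + 1)) ((k : ℝ) / ((n : ℝ) + 1)) w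
        - action f xs l₀ l₁ l₂ ((j : ℝ) / ((n : ℝ) + 1)) ((k : ℝ) / ((n : ℝ) + 1)) z)) *
      correction l₀ l₁ l₂ ((eps f xs n H j k + 1) / 2) z w =
      w ^ a * ((z + 1) ^ b * (z - 1) ^ c) / (z ^ a * ((w + 1) ^ b * (w - 1) ^ c)) := by
    unfold correction
    rw [← exp_add, key, exp_sub]
    simp only [exp_add, exp_nat_mul, hl₀ w h4, hl₀ z h1, hl₁ _ h2, hl₁ _ h5, hl₂ _ h3, hl₂ _ h6]
  rw [mul_right_comm (exp _) (g z w), hexp, towerKernel, div_mul_eq_div_div _ _ (z - w)]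
  ring

/-! ### Geometry of the Aztec diamond -/

/-- The sides of a face in the cyclic order east, north, west, south. -/
def side (q : ℤ × ℤ) : Fin 4 → Sym2 Vertex :=
  ![eastEdge q.1 q.2, northEdge q.1 q.2, westEdge q.1 q.2, southEdge q.1 q.2]

/-- The corners of a face in cyclic order, the corner `i` lying between the sides `i` and
`i + 1`. -/
def corner (q : ℤ × ℤ) : Fin 4 → Vertex :=
  ![(q.1, q.2), (q.1 - 1, q.2), (q.1 - 1, q.2 - 1), (q.1, q.2 - 1)]

/-- The faces of the Aztec diamond of rank `n + 1` in the colour class of its outermost faces. They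
are the faces shuffled in passing from rank `n` to rank `n + 1`. -/
def activeFaces (n : ℕ) : Finset (ℤ × ℤ) :=
  (aztecFaces (n + 1)).filter (fun q => Even (q.1 + q.2 + n))

theorem mem_aztecFaces {n : ℕ} {q : ℤ × ℤ} : q ∈ aztecFaces n ↔ |q.1| + |q.2| ≤ (n : ℤ) - 1 := by
  simp only [aztecFaces, Finset.mem_filter, Finset.mem_product, Finset.mem_Icc]
  refine ⟨fun h => h.2, fun h => ⟨?_, h⟩⟩
  rw [Int.abs_eq_natAbs, Int.abs_eq_natAbs] at h
  omega

theorem mem_activeFaces {n : ℕ} {q : ℤ × ℤ} :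
    q ∈ activeFaces n ↔ |q.1| + |q.2| ≤ (n : ℤ) ∧ (q.1 + q.2 + n) % 2 = 0 := by
  simp only [activeFaces, Finset.mem_filter, mem_aztecFaces, Int.even_iff]
  push_cast
  simp

theorem mem_aztecVertices {n : ℕ} {v : Vertex} :
    v ∈ aztecVertices n ↔ |2 * v.1 + 1| + |2 * v.2 + 1| ≤ 2 * (n : ℤ) := by
  obtain ⟨a, b⟩ := v
  simp only [aztecVertices, Finset.mem_biUnion, mem_aztecFaces, Finset.mem_insert,
    Finset.mem_singleton, Prod.mk.injEq, Prod.exists, Int.abs_eq_natAbs]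
  constructor
  · rintro ⟨j, k, h, h'⟩
    omega
  · intro h
    refine ⟨if 0 ≤ a then a else a + 1, if 0 ≤ b then b else b + 1, ?_, ?_⟩ <;> split_ifs <;> omega

theorem side_eq_iff {q q' : ℤ × ℤ} (hq : (q.1 + q.2 + q'.1 + q'.2) % 2 = 0) {d d' : Fin 4}
    (h : side q d = side q' d') : q = q' ∧ d = d' := by
  obtain ⟨j, k⟩ := q
  obtain ⟨j', k'⟩ := q'
  simp only at hq
  fin_cases d <;> fin_cases d' <;>
    simp [side, eastEdge, northEdge, westEdge, southEdge] at h ⊢ <;> omega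

theorem mem_side_iff {q : ℤ × ℤ} {d : Fin 4} {v : Vertex} :
    v ∈ side q d ↔ v = corner q d ∨ v = corner q (d - 1) := by
  obtain ⟨j, k⟩ := q
  fin_cases d <;> simp [side, corner, eastEdge, northEdge, westEdge, southEdge, Sym2.mem_iff] <;>
    tauto

theorem corner_injective (q : ℤ × ℤ) : Function.Injective (corner q) := by
  obtain ⟨j, k⟩ := q
  intro i i' h
  fin_cases i <;> fin_cases i' <;> simp [corner] at h ⊢ <;> omega

theorem mem_aztecEdges {n : ℕ} {e : Sym2 Vertex} :
    e ∈ aztecEdges n ↔ ∃ q ∈ aztecFaces n, ∃ d, e = side q d := by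
  simp only [aztecEdges, Finset.mem_biUnion, Finset.mem_insert, Finset.mem_singleton, side,
    Fin.exists_fin_succ]
  simp

theorem mem_aztecEdges_succ {n : ℕ} {e : Sym2 Vertex} :
    e ∈ aztecEdges (n + 1) ↔ ∃ q ∈ activeFaces n, ∃ d, e = side q d := by
  rw [mem_aztecEdges]
  constructor
  · rintro ⟨⟨j, k⟩, hq, d, rfl⟩
    rw [mem_aztecFaces] at hq
    simp only [mem_activeFaces, Prod.exists, Int.abs_eq_natAbs]
    push_cast at hq
    simp only [Int.abs_eq_natAbs] at hq
    by_cases hpar : (j + k + n) % 2 = 0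
    · exact ⟨j, k, ⟨by simpa using hq, hpar⟩, d, rfl⟩
    · fin_cases d
      · refine ⟨j + 1, k, ⟨?_, by omega⟩, 2, ?_⟩
        · omega
        · simp [side, eastEdge, westEdge]
      · refine ⟨j, k + 1, ⟨?_, by omega⟩, 3, ?_⟩
        · omega
        · simp [side, northEdge, southEdge]
      · refine ⟨j - 1, k, ⟨?_, by omega⟩, 0, ?_⟩
        · omega
        · simp [side, eastEdge, westEdge]
      · refine ⟨j, k - 1, ⟨?_, by omega⟩, 1, ?_⟩
        · omega
        · simp [side, northEdge, southEdge]
  · rintro ⟨q, hq, h⟩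
    exact ⟨q, (Finset.mem_filter.1 hq).1, h⟩

/-- The Aztec diamond is an induced subgraph of the next one. -/
theorem side_mem_aztecEdges_iff {n : ℕ} {q : ℤ × ℤ} {d : Fin 4} :
    side q d ∈ aztecEdges n ↔ ∀ v ∈ side q d, v ∈ aztecVertices n := by
  rw [mem_aztecEdges]
  constructor
  · rintro ⟨q', hq', d', h⟩ v hv
    rw [h, mem_side_iff] at hv
    obtain ⟨j, k⟩ := q'
    rw [mem_aztecVertices]
    rw [mem_aztecFaces] at hq'
    simp only [Int.abs_eq_natAbs] at hq' ⊢
    rcases hv with rfl | rfl <;> fin_cases d' <;> simp [corner, -Nat.cast_natAbs] <;> omega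
  · intro h
    simp only [mem_side_iff] at h
    have h1 := h _ (Or.inl rfl)
    have h2 := h _ (Or.inr rfl)
    clear h
    obtain ⟨j, k⟩ := q
    simp only [mem_aztecVertices, Int.abs_eq_natAbs, corner] at h1 h2
    simp only [mem_aztecFaces, Prod.exists, Int.abs_eq_natAbs]
    by_cases hjk : (j.natAbs : ℤ) + k.natAbs ≤ n - 1
    · exact ⟨j, k, hjk, d, rfl⟩
    fin_cases d <;> simp [-Nat.cast_natAbs] at h1 h2
    · refine ⟨j + 1, k, ?_, 2, ?_⟩
      · omega
      · simp [side, eastEdge, westEdge]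
    · refine ⟨j, k + 1, ?_, 3, ?_⟩
      · omega
      · simp [side, northEdge, southEdge]
    · refine ⟨j - 1, k, ?_, 0, ?_⟩
      · omega
      · simp [side, eastEdge, westEdge]
    · refine ⟨j, k - 1, ?_, 1, ?_⟩
      · omega
      · simp [side, northEdge, southEdge]

/-! ### Domino shuffling: states and profiles of a face -/

/-- A state of a face: which of its four sides are covered. -/
abbrev State := Fin 4 → Bool

/-- The number of covered sides of a face at its corner `i`. -/
def cornerCount (s : State) (i : Fin 4) : ℕ := (s i).toNat + (s (i + 1)).toNat

/-- The covered sides of a face do not meet. -/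
def IsMatchingState (s : State) : Prop := ∀ i, ¬(s i = true ∧ s (i + 1) = true)

instance : DecidablePred IsMatchingState := fun s => by unfold IsMatchingState; infer_instance

/-- The profile of a state: which of the corners of the face lie on a covered side. -/
def profile (s : State) (i : Fin 4) : Bool := s i || s (i + 1)

/-- The matching states with a given profile. There are two of them if all corners are covered
(two parallel sides in either direction), otherwise at most one. -/
def profileFiber (π : State) : Finset State :=
  Finset.univ.filter (fun s => IsMatchingState s ∧ profile s = π)

theorem cornerCount_eq_of_isMatching {s : State} (hs : IsMatchingState s) (i : Fin 4) :
    cornerCount s i = (profile s i).toNat := by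
  have := hs i
  unfold cornerCount profile
  cases h1 : s i <;> cases h2 : s (i + 1) <;> simp_all

theorem isMatching_of_cornerCount_le {s : State} (hs : ∀ i, cornerCount s i ≤ 1) :
    IsMatchingState s := by
  rintro i ⟨h1, h2⟩
  have := hs i
  simp [cornerCount, h1, h2] at this

set_option maxRecDepth 10000 in
/-- The local effect of complementing the profile of a face, which is the effect of shuffling: up
to a power of `2` fixed by the number of covered corners, the number of states with the
complementary profile is the same, and a side gets covered if the opposite side was the only covered
one, or in half of the new states if no side was. -/
theorem profileFiber_compl (π : State) :
    ((profileFiber π).card = 0 ∧ (profileFiber (fun i => !π i)).card = 0) ∨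
    ∃ m : Fin 3, ∑ i, (π i).toNat = 2 * (m : ℕ) ∧
      2 ^ (m : ℕ) * (profileFiber (fun i => !π i)).card = 2 * (profileFiber π).card ∧
      ∀ d, 2 ^ (m : ℕ) * ((profileFiber (fun i => !π i)).filter (fun s => s d = true)).card +
          ∑ d', ((profileFiber π).filter (fun s => s d' = true)).card =
        2 * ((profileFiber π).filter (fun s => s (d + 2) = true)).card + (profileFiber π).card := by
  revert π
  decide

/-! ### Dimer covers as configurations of states -/

/-- The states of the active faces given by a set of edges. -/
def config (n : ℕ) (m : Finset (Sym2 Vertex)) (q : activeFaces n) (d : Fin 4) : Bool :=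
  decide (side q d ∈ m)

/-- The edges of a configuration of states. -/
def edgesOf {n : ℕ} (c : activeFaces n → State) : Finset (Sym2 Vertex) :=
  (Finset.univ.filter (fun x : activeFaces n × Fin 4 => c x.1 x.2 = true)).image
    (fun x => side x.1 x.2)

theorem side_injective (n : ℕ) :
    Function.Injective (fun x : activeFaces n × Fin 4 => side (x.1 : ℤ × ℤ) x.2) := by
  rintro ⟨⟨q, hq⟩, d⟩ ⟨⟨q', hq'⟩, d'⟩ h
  rw [mem_activeFaces] at hq hq'
  obtain ⟨rfl, rfl⟩ := side_eq_iff (q := q) (q' := q') (by omega) h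
  rfl

theorem side_mem_edgesOf {n : ℕ} {c : activeFaces n → State} {q : activeFaces n} {d : Fin 4} :
    side q d ∈ edgesOf c ↔ c q d = true := by
  unfold edgesOf
  rw [Finset.mem_image]
  constructor
  · rintro ⟨x, hx, h⟩
    have : x = (q, d) := side_injective n h
    subst this
    exact (Finset.mem_filter.1 hx).2
  · intro h
    exact ⟨(q, d), by simpa using h, rfl⟩

theorem config_edgesOf {n : ℕ} (c : activeFaces n → State) : config n (edgesOf c) = c := by
  ext q d
  simp [config, side_mem_edgesOf]

theorem edgesOf_subset {n : ℕ} (c : activeFaces n → State) : edgesOf c ⊆ aztecEdges (n + 1) := by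
  intro e he
  obtain ⟨x, -, rfl⟩ := Finset.mem_image.1 he
  exact mem_aztecEdges_succ.2 ⟨x.1, x.1.2, x.2, rfl⟩

theorem edgesOf_config {n : ℕ} {m : Finset (Sym2 Vertex)} (hm : m ⊆ aztecEdges (n + 1)) :
    edgesOf (config n m) = m := by
  ext e
  constructor
  · intro he
    obtain ⟨x, hx, rfl⟩ := Finset.mem_image.1 he
    simpa [config] using hx
  · intro he
    obtain ⟨q, hq, d, rfl⟩ := mem_aztecEdges_succ.1 (hm he)
    exact (side_mem_edgesOf (q := ⟨q, hq⟩)).2 (by simpa [config] using he)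

/-- The number of pairs of an active face and one of its corners at `v`, weighted by `u`. -/
def cornerSum {n : ℕ} (u : activeFaces n → Fin 4 → ℕ) (v : Vertex) : ℕ :=
  ∑ q : activeFaces n, ∑ i, if corner (q : ℤ × ℤ) i = v then u q i else 0

theorem cornerCount_sum (q : ℤ × ℤ) (s : State) (v : Vertex) :
    (∑ d, if s d = true ∧ v ∈ side q d then 1 else 0) =
      ∑ i, if corner q i = v then cornerCount s i else 0 := by
  simp only [mem_side_iff, eq_comm (a := v)]
  by_cases h : ∃ i, corner q i = v
  · obtain ⟨i, rfl⟩ := h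
    simp only [(corner_injective q).eq_iff]
    revert i s
    decide
  · push Not at h
    simp [h]

/-- The degree of a vertex in a set of edges, as a sum over the corners of active faces. -/
theorem card_filter_mem_edgesOf {n : ℕ} (c : activeFaces n → State) (v : Vertex) :
    ((edgesOf c).filter (fun e => v ∈ e)).card = cornerSum (fun q => cornerCount (c q)) v := by
  unfold edgesOf cornerSum
  rw [Finset.filter_image, Finset.card_image_of_injective _ (side_injective n),
    Finset.filter_filter, Finset.card_filter, ← Finset.univ_product_univ, Finset.sum_product]
  exact Finset.sum_congr rfl fun q _ => cornerCount_sum q (c q) v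

theorem cornerSum_one {n : ℕ} {v : Vertex} (hv : v ∈ aztecVertices (n + 1)) :
    cornerSum (fun (_ : activeFaces n) _ => 1) v = 1 + if v ∈ aztecVertices n then 1 else 0 := by
  obtain ⟨a, b⟩ := v
  have h : ∀ i : Fin 4, ∀ p : ℤ × ℤ, (∀ q, corner q i = (a, b) ↔ q = p) →
      (∑ q : activeFaces n, if corner (q : ℤ × ℤ) i = (a, b) then 1 else 0) =
        if p ∈ activeFaces n then 1 else 0 := by
    intro i p hp
    rw [Finset.sum_coe_sort (activeFaces n) (fun q => if corner q i = (a, b) then 1 else 0)]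
    simp only [hp, Finset.sum_ite_eq']
  unfold cornerSum
  rw [Finset.sum_comm, Fin.sum_univ_four, h 0 (a, b), h 1 (a + 1, b), h 2 (a + 1, b + 1),
    h 3 (a, b + 1)]
  · simp only [mem_aztecVertices, mem_activeFaces, Int.abs_eq_natAbs] at hv ⊢
    push_cast at hv
    simp only [Int.abs_eq_natAbs] at hv
    split_ifs <;> omega
  all_goals
    rintro ⟨j, k⟩
    simp [corner]
    try omega

theorem corner_mem_aztecVertices {n : ℕ} (q : activeFaces n) (i : Fin 4) :
    corner q i ∈ aztecVertices (n + 1) := by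
  obtain ⟨⟨j, k⟩, hq⟩ := q
  have := (Finset.mem_filter.1 hq).1
  refine Finset.mem_biUnion.2 ⟨_, this, ?_⟩
  fin_cases i <;> simp [corner]

/-- A dimer cover of the Aztec diamond of rank `n` is a set of edges of the one of rank `n + 1` with
degree `1` at the vertices of the smaller and degree `0` at the other vertices. -/
theorem mem_aztecDimerCovers_iff {n : ℕ} {m : Finset (Sym2 Vertex)} :
    m ∈ aztecDimerCovers n ↔ m ⊆ aztecEdges (n + 1) ∧ ∀ v ∈ aztecVertices (n + 1),
      (m.filter (fun e => v ∈ e)).card = if v ∈ aztecVertices n then 1 else 0 := by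
  have hVV : aztecVertices n ⊆ aztecVertices (n + 1) := by
    intro v hv
    rw [mem_aztecVertices] at hv ⊢
    push_cast
    omega
  simp only [aztecDimerCovers, Finset.mem_filter, Finset.mem_powerset]
  constructor
  · rintro ⟨hm, hv⟩
    refine ⟨fun e he => ?_, fun v _ => ?_⟩
    · obtain ⟨q, hq, d, rfl⟩ := mem_aztecEdges.1 (hm he)
      exact side_mem_aztecEdges_iff.2 fun v hv => hVV (side_mem_aztecEdges_iff.1 (hm he) v hv)
    · split_ifs with h
      · exact hv v h
      · rw [Finset.card_eq_zero, Finset.filter_eq_empty_iff]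
        intro e he hve
        obtain ⟨q, hq, d, rfl⟩ := mem_aztecEdges.1 (hm he)
        exact h (side_mem_aztecEdges_iff.1 (hm he) v hve)
  · rintro ⟨hm, hv⟩
    refine ⟨fun e he => ?_, fun v h => by rw [hv v (hVV h), if_pos h]⟩
    obtain ⟨q, hq, d, rfl⟩ := mem_aztecEdges.1 (hm he)
    refine side_mem_aztecEdges_iff.2 fun v hve => ?_
    by_contra h
    have := hv v (side_mem_aztecEdges_iff.1 (hm he) v hve)
    rw [if_neg h, Finset.card_eq_zero, Finset.filter_eq_empty_iff] at this
    exact this he hve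

open Classical in
/-- The profiles of the active faces that have prescribed vertex degrees. -/
def validProfiles (n : ℕ) (t : Vertex → ℕ) : Finset (activeFaces n → State) :=
  Finset.univ.filter (fun π : activeFaces n → State => ∀ v ∈ aztecVertices (n + 1),
    cornerSum (fun q i => (π q i).toNat) v = t v)

/-- Summation over the sets of edges with prescribed degrees at most `1`, of a quantity `ω` that
only depends on the state of one face: the profiles of the faces are summed over, and given these
the states of the faces are independent. -/
theorem sum_eq_sum_validProfiles {n : ℕ} {t : Vertex → ℕ} (ht : ∀ v, t v ≤ 1)
    {X : Finset (Finset (Sym2 Vertex))}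
    (hX : ∀ m, m ∈ X ↔ m ⊆ aztecEdges (n + 1) ∧ ∀ v ∈ aztecVertices (n + 1),
      (m.filter (fun e => v ∈ e)).card = t v) (q₀ : activeFaces n) (ω : State → ℝ) :
    ∑ m ∈ X, ω (config n m q₀) =
      ∑ π ∈ validProfiles n t, (∑ s ∈ profileFiber (π q₀), ω s) *
        ∏ q ∈ Finset.univ.erase q₀, ((profileFiber (π q)).card : ℝ) := by
  classical
  set Y : Finset (activeFaces n → State) := Finset.univ.filter (fun c =>
    (∀ q, IsMatchingState (c q)) ∧ (fun q => profile (c q)) ∈ validProfiles n t) with hY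
  have h1 : ∑ m ∈ X, ω (config n m q₀) = ∑ c ∈ Y, ω (c q₀) := by
    have hmem : ∀ c : activeFaces n → State, edgesOf c ∈ X ↔ c ∈ Y := by
      intro c
      rw [hX, hY]
      simp only [edgesOf_subset, true_and, card_filter_mem_edgesOf, validProfiles,
        Finset.mem_filter, Finset.mem_univ]
      constructor
      · intro h
        have hmatch : ∀ q, IsMatchingState (c q) := by
          intro q
          refine isMatching_of_cornerCount_le fun i => ?_
          have h' := (h _ (corner_mem_aztecVertices q i)).le.trans (ht _)
          refine le_trans ?_ h'
          unfold cornerSum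
          refine le_trans ?_ (Finset.single_le_sum (fun q' _ => Nat.zero_le _) (Finset.mem_univ q))
          refine le_trans ?_ (Finset.single_le_sum (fun q' _ => Nat.zero_le _) (Finset.mem_univ i))
          simp
        refine ⟨hmatch, fun v hv => ?_⟩
        rw [← h v hv]
        unfold cornerSum
        simp only [cornerCount_eq_of_isMatching (hmatch _)]
      · rintro ⟨hmatch, h⟩ v hv
        rw [← h v hv]
        unfold cornerSum
        simp only [cornerCount_eq_of_isMatching (hmatch _)]
    refine Finset.sum_bij' (fun m _ => config n m) (fun c _ => edgesOf c) ?_ ?_ ?_ ?_ ?_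
    · intro m hm
      rw [← hmem, edgesOf_config ((hX m).1 hm).1]
      exact hm
    · exact fun c hc => (hmem c).2 hc
    · exact fun m hm => edgesOf_config ((hX m).1 hm).1
    · exact fun c _ => config_edgesOf c
    · exact fun m _ => rfl
  have h2 : ∀ c ∈ Y, (fun q => profile (c q)) ∈ validProfiles n t := fun c hc =>
    (Finset.mem_filter.1 hc).2.2
  rw [h1, ← Finset.sum_fiberwise_of_maps_to h2]
  refine Finset.sum_congr rfl fun π hπ => ?_
  have h3 : Y.filter (fun c => (fun q => profile (c q)) = π) =
      Fintype.piFinset (fun q => profileFiber (π q)) := by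
    ext c
    simp only [hY, Finset.mem_filter, Finset.mem_univ, true_and, Fintype.mem_piFinset, profileFiber]
    constructor
    · rintro ⟨⟨h, -⟩, rfl⟩ q
      exact ⟨h q, rfl⟩
    · intro h
      have : (fun q => profile (c q)) = π := funext fun q => (h q).2
      exact ⟨⟨fun q => (h q).1, this ▸ hπ⟩, this⟩
  have h4 := Finset.prod_univ_sum (fun q => profileFiber (π q))
    (fun q s => if q = q₀ then ω s else 1)
  rw [h3]
  rw [← Finset.mul_prod_erase _ _ (Finset.mem_univ q₀)] at h4
  simp only [if_true] at h4
  rw [Finset.prod_congr rfl (g := fun q => ((profileFiber (π q)).card : ℝ))] at h4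
  · rw [h4]
    refine Finset.sum_congr rfl fun c _ => ?_
    rw [Finset.prod_ite_eq' Finset.univ q₀ (fun q => ω (c q)), if_pos (Finset.mem_univ _)]
  · intro q hq
    simp [(Finset.mem_erase.1 hq).1]

/-! ### The recurrence for edge probabilities -/

/-- The prescribed degrees for the covers of rank `n`, inside the Aztec diamond of rank `n + 1`. -/
def innerDegree (n : ℕ) (v : Vertex) : ℕ := if v ∈ aztecVertices n then 1 else 0

theorem mem_aztecDimerCovers_succ_iff {n : ℕ} {m : Finset (Sym2 Vertex)} :
    m ∈ aztecDimerCovers (n + 1) ↔ m ⊆ aztecEdges (n + 1) ∧ ∀ v ∈ aztecVertices (n + 1),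
      (m.filter (fun e => v ∈ e)).card = 1 := by
  simp only [aztecDimerCovers, Finset.mem_filter, Finset.mem_powerset]

theorem cornerSum_compl {n : ℕ} (π : activeFaces n → State) {v : Vertex}
    (hv : v ∈ aztecVertices (n + 1)) :
    cornerSum (fun q i => (!π q i).toNat) v + cornerSum (fun q i => (π q i).toNat) v =
      1 + innerDegree n v := by
  unfold innerDegree
  rw [← cornerSum_one hv]
  unfold cornerSum
  simp only [← Finset.sum_add_distrib]
  refine Finset.sum_congr rfl fun q _ => Finset.sum_congr rfl fun i _ => ?_
  split_ifs
  · cases π q i <;> rfl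
  · rfl

/-- Complementing all profiles exchanges the covers of consecutive ranks. -/
theorem sum_validProfiles_succ (n : ℕ) (F : (activeFaces n → State) → ℝ) :
    ∑ π ∈ validProfiles n (fun _ => 1), F π =
      ∑ π ∈ validProfiles n (innerDegree n), F (fun q i => !π q i) := by
  refine Finset.sum_bij' (fun π _ q i => !π q i) (fun π _ q i => !π q i) ?_ ?_ ?_ ?_ ?_
  · intro π hπ
    simp only [validProfiles, Finset.mem_filter, Finset.mem_univ, true_and] at hπ ⊢
    intro v hv
    have h1 := hπ v hv
    have h2 := cornerSum_compl π hv
    omega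
  · intro π hπ
    simp only [validProfiles, Finset.mem_filter, Finset.mem_univ, true_and] at hπ ⊢
    intro v hv
    have h1 := hπ v hv
    have h2 := cornerSum_compl π hv
    omega
  · intros; simp
  · intros; simp
  · intros; simp

/-- The number of covered corners is the same for all dimer covers. -/
theorem sum_profile_toNat {n : ℕ} {t : Vertex → ℕ} {π : activeFaces n → State}
    (hπ : π ∈ validProfiles n t) :
    ∑ q, ∑ i, (π q i).toNat = ∑ v ∈ aztecVertices (n + 1), t v := by
  simp only [validProfiles, Finset.mem_filter, Finset.mem_univ, true_and] at hπ
  have h : ∑ v ∈ aztecVertices (n + 1), cornerSum (fun q i => (π q i).toNat) v =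
      ∑ v ∈ aztecVertices (n + 1), t v := Finset.sum_congr rfl hπ
  rw [← h]
  unfold cornerSum
  symm
  rw [Finset.sum_comm]
  refine Finset.sum_congr rfl fun q _ => ?_
  rw [Finset.sum_comm]
  refine Finset.sum_congr rfl fun i _ => ?_
  rw [Finset.sum_ite_eq, if_pos (corner_mem_aztecVertices q i)]

theorem sum_indicator_eq (S : Finset State) (d : Fin 4) :
    ∑ s ∈ S, (if s d = true then (1 : ℝ) else 0) = (S.filter (fun s => s d = true)).card := by
  rw [Finset.card_filter]
  push_cast
  rfl

theorem sqrt_two_pow_mul_card_profileFiber (π : State) :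
    √2 ^ (∑ i, (π i).toNat) * ((profileFiber (fun i => !π i)).card : ℝ) =
      2 * ((profileFiber π).card : ℝ) := by
  rcases profileFiber_compl π with ⟨h1, h2⟩ | ⟨m, h1, h2, -⟩
  · simp [h1, h2]
  · rw [h1, pow_mul, Real.sq_sqrt (by norm_num)]
    exact_mod_cast h2

theorem sqrt_two_pow_mul_sum_profileFiber (π : State) (d : Fin 4) :
    √2 ^ (∑ i, (π i).toNat) *
        ∑ s ∈ profileFiber (fun i => !π i), (if s d = true then (1 : ℝ) else 0) =
      2 * ∑ s ∈ profileFiber π, (if s (d + 2) = true then (1 : ℝ) else 0) +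
        (∑ _s ∈ profileFiber π, 1 -
          ∑ d', ∑ s ∈ profileFiber π, (if s d' = true then (1 : ℝ) else 0)) := by
  simp only [sum_indicator_eq]
  rcases profileFiber_compl π with ⟨h1, h2⟩ | ⟨m, h1, -, h3⟩
  · rw [Finset.card_eq_zero] at h1 h2
    simp [h1, h2]
  · rw [h1, pow_mul, Real.sq_sqrt (by norm_num)]
    have := h3 d
    have : (2 : ℝ) ^ (m : ℕ) *
        ((profileFiber (fun i => !π i)).filter (fun s => s d = true)).card +
          ∑ d', (((profileFiber π).filter (fun s => s d' = true)).card : ℝ) =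
        2 * ((profileFiber π).filter (fun s => s (d + 2) = true)).card +
          (profileFiber π).card := by exact_mod_cast this
    rw [Finset.sum_const, nsmul_eq_mul, mul_one]
    linear_combination this

/-- The number of dimer covers of rank `n` that contain the edge `e`. -/
def coverCount (n : ℕ) (e : Sym2 Vertex) : ℝ :=
  (((aztecDimerCovers n).filter (fun m => e ∈ m)).card : ℝ)

/-- Passing from rank `n` to rank `n + 1` multiplies the number of dimer covers by a constant, and
changes the number of those that contain a given side by the same constant and the rule of
shuffling. -/
theorem exists_coverCount_succ (n : ℕ) (q₀ : activeFaces n) :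
    ∃ K : ℝ, 0 < K ∧ ((aztecDimerCovers (n + 1)).card : ℝ) = K * (aztecDimerCovers n).card ∧
      ∀ d, coverCount (n + 1) (side q₀ d) = K * (coverCount n (side q₀ (d + 2)) +
        ((aztecDimerCovers n).card - ∑ d', coverCount n (side q₀ d')) / 2) := by
  set M : ℕ := ∑ v ∈ aztecVertices (n + 1), innerDegree n v with hM
  set P : ℝ := ∏ q ∈ Finset.univ.erase q₀, (2 : ℝ) with hP
  have hPpos : 0 < P := Finset.prod_pos fun _ _ => by norm_num
  have hθ : (0 : ℝ) < √2 ^ M := by positivity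
  have hsum0 := fun ω => sum_eq_sum_validProfiles (t := innerDegree n)
    (fun v => by unfold innerDegree; split_ifs <;> omega)
    (X := aztecDimerCovers n) (fun m => mem_aztecDimerCovers_iff) q₀ ω
  have hsum1 := fun ω => sum_eq_sum_validProfiles (t := fun _ => 1) (fun v => le_rfl)
    (X := aztecDimerCovers (n + 1)) (fun m => mem_aztecDimerCovers_succ_iff) q₀ ω
  simp only [sum_validProfiles_succ] at hsum1
  -- The power of `√2` is distributed over the faces by counting corners.
  have hpull : ∀ ω : State → ℝ, √2 ^ M * ∑ m ∈ aztecDimerCovers (n + 1), ω (config n m q₀) =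
      P * ∑ π ∈ validProfiles n (innerDegree n),
        (√2 ^ (∑ i, (π q₀ i).toNat) * ∑ s ∈ profileFiber (fun i => !π q₀ i), ω s) *
          ∏ q ∈ Finset.univ.erase q₀, ((profileFiber (π q)).card : ℝ) := by
    intro ω
    rw [hsum1, Finset.mul_sum, Finset.mul_sum]
    refine Finset.sum_congr rfl fun π hπ => ?_
    rw [hM, ← sum_profile_toNat hπ, ← Finset.add_sum_erase _ _ (Finset.mem_univ q₀), pow_add]
    have : √2 ^ (∑ q ∈ Finset.univ.erase q₀, ∑ i, (π q i).toNat) *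
        ∏ q ∈ Finset.univ.erase q₀, ((profileFiber (fun i => !π q i)).card : ℝ) =
        P * ∏ q ∈ Finset.univ.erase q₀, ((profileFiber (π q)).card : ℝ) := by
      rw [hP, ← Finset.prod_pow_eq_pow_sum, ← Finset.prod_mul_distrib, ← Finset.prod_mul_distrib]
      exact Finset.prod_congr rfl fun q _ => sqrt_two_pow_mul_card_profileFiber (π q)
    linear_combination (√2 ^ (∑ i, (π q₀ i).toNat) *
      ∑ s ∈ profileFiber (fun i => !π q₀ i), ω s) * this
  have hcount : ∀ n' d, coverCount n' (side q₀ d) = ∑ m ∈ aztecDimerCovers n',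
      if config n m q₀ d = true then (1 : ℝ) else 0 := by
    intro n' d
    unfold coverCount
    rw [Finset.card_filter]
    push_cast
    simp [config]
  have hcard₀ : ((aztecDimerCovers n).card : ℝ) = ∑ π ∈ validProfiles n (innerDegree n),
      (∑ _s ∈ profileFiber (π q₀), (1 : ℝ)) *
        ∏ q ∈ Finset.univ.erase q₀, ((profileFiber (π q)).card : ℝ) := by
    rw [← hsum0 (fun _ => 1)]
    simp
  have hcount₀ : ∀ d, coverCount n (side q₀ d) = ∑ π ∈ validProfiles n (innerDegree n),
      (∑ s ∈ profileFiber (π q₀), if s d = true then (1 : ℝ) else 0) *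
        ∏ q ∈ Finset.univ.erase q₀, ((profileFiber (π q)).card : ℝ) := fun d =>
    (hcount n d).trans (hsum0 (fun s => if s d = true then 1 else 0))
  refine ⟨2 * P / √2 ^ M, by positivity, ?_, fun d => ?_⟩
  · have h1 : √2 ^ M * ((aztecDimerCovers (n + 1)).card : ℝ) =
        P * (2 * (aztecDimerCovers n).card) := by
      have h2 := hpull (fun _ => 1)
      simp only [Finset.sum_const, nsmul_eq_mul, mul_one] at h2 hcard₀
      rw [h2, hcard₀]
      refine congrArg (fun x => P * x) ?_
      rw [Finset.mul_sum]
      refine Finset.sum_congr rfl fun π _ => ?_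
      rw [sqrt_two_pow_mul_card_profileFiber (π q₀)]
      ring
    field_simp
    linear_combination h1
  · have h1 : √2 ^ M * coverCount (n + 1) (side q₀ d) =
        P * (2 * coverCount n (side q₀ (d + 2)) +
          ((aztecDimerCovers n).card - ∑ d', coverCount n (side q₀ d'))) := by
      rw [hcount (n + 1) d]
      refine (hpull (fun s => if s d = true then 1 else 0)).trans ?_
      simp only [hcount₀]
      rw [hcard₀]
      refine congrArg (fun x => P * x) ?_
      rw [Finset.sum_comm, ← Finset.sum_sub_distrib, Finset.mul_sum, ← Finset.sum_add_distrib]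
      refine Finset.sum_congr rfl fun π _ => ?_
      rw [sqrt_two_pow_mul_sum_profileFiber (π q₀) d, ← Finset.sum_mul]
      ring
    field_simp
    linear_combination h1

theorem card_aztecDimerCovers_pos (n : ℕ) : (0 : ℝ) < (aztecDimerCovers n).card := by
  induction n with
  | zero =>
    have hV : aztecVertices 0 = ∅ := by
      ext v
      simp only [mem_aztecVertices, Finset.notMem_empty, iff_false, Int.abs_eq_natAbs]
      omega
    have : ∅ ∈ aztecDimerCovers 0 := by simp [aztecDimerCovers, hV]
    exact_mod_cast Finset.card_pos.2 ⟨_, this⟩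
  | succ n ih =>
    have hq : ((n : ℤ), (0 : ℤ)) ∈ activeFaces n := by
      rw [mem_activeFaces]
      simp
      omega
    obtain ⟨K, hK, h, -⟩ := exists_coverCount_succ n ⟨_, hq⟩
    rw [h]
    positivity

/-- The recurrence of domino shuffling: a side of an active face is covered if the opposite side
was, corrected by half the net rate of creation of pairs. -/
theorem edgeProb_succ {n : ℕ} {q : ℤ × ℤ} (hq : q ∈ activeFaces n) (d : Fin 4) :
    edgeProb (n + 1) (side q d) =
      edgeProb n (side q (d + 2)) + (1 - ∑ d', edgeProb n (side q d')) / 2 := by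
  obtain ⟨K, hK, h, h'⟩ := exists_coverCount_succ n ⟨q, hq⟩
  have hpos := card_aztecDimerCovers_pos n
  have h'' := h' d
  unfold coverCount at h''
  unfold edgeProb
  rw [h, h'', ← Finset.sum_div]
  field_simp

theorem edgeProb_eq_zero {n : ℕ} {e : Sym2 Vertex} (he : e ∉ aztecEdges n) : edgeProb n e = 0 := by
  unfold edgeProb
  rw [Finset.filter_eq_empty_iff.2, Finset.card_empty, Nat.cast_zero, zero_div]
  intro m hm hem
  exact he (Finset.mem_powerset.1 (Finset.mem_filter.1 hm).1 hem)

/-- A side of a face outside the Aztec diamond of rank `n`, of the colour class of the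
outermost faces, is not an edge of it. -/
theorem side_notMem_aztecEdges {n : ℕ} {q : ℤ × ℤ} (hq : (q.1 + q.2 + n) % 2 = 1)
    (hq' : (n : ℤ) ≤ |q.1| + |q.2|) (d : Fin 4) : side q d ∉ aztecEdges n := by
  rw [side_mem_aztecEdges_iff]
  intro h
  simp only [mem_side_iff] at h
  have h1 := h _ (Or.inl rfl)
  have h2 := h _ (Or.inr rfl)
  obtain ⟨j, k⟩ := q
  simp only [mem_aztecVertices, Int.abs_eq_natAbs, corner] at h1 h2
  simp only [Int.abs_eq_natAbs] at hq hq'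
  fin_cases d <;> simp [-Nat.cast_natAbs] at h1 h2 <;> omega

/-- The recurrence in terms of the four neighbouring faces, whose sides are shared. -/
theorem edgeProb_face_succ {n : ℕ} {j k : ℤ} (h : |j| + |k| ≤ (n : ℤ))
    (hpar : (j + k + n) % 2 = 0) :
    let D := 1 - (pE (j - 1) k n + pN j (k - 1) n + pW (j + 1) k n + pS j (k + 1) n)
    pE j k (n + 1) = pE (j - 1) k n + D / 2 ∧ pN j k (n + 1) = pN j (k - 1) n + D / 2 ∧
      pW j k (n + 1) = pW (j + 1) k n + D / 2 ∧ pS j k (n + 1) = pS j (k + 1) n + D / 2 := by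
  intro D
  have hq : (j, k) ∈ activeFaces n := mem_activeFaces.2 ⟨h, hpar⟩
  have h0 := edgeProb_succ hq 0
  have h1 := edgeProb_succ hq 1
  have h2 := edgeProb_succ hq 2
  have h3 := edgeProb_succ hq 3
  have e1 : eastEdge (j - 1) k = westEdge j k := by simp [eastEdge, westEdge]
  have e2 : northEdge j (k - 1) = southEdge j k := by simp [northEdge, southEdge]
  have e3 : westEdge (j + 1) k = eastEdge j k := by simp [eastEdge, westEdge]
  have e4 : southEdge j (k + 1) = northEdge j k := by simp [northEdge, southEdge]
  simp only [Fin.sum_univ_four, side, Fin.isValue, Fin.reduceAdd, Matrix.cons_val] at h0 h1 h2 h3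
  simp only [D, pE, pN, pW, pS, e1, e2, e3, e4]
  refine ⟨?_, ?_, ?_, ?_⟩ <;> linarith

/-! ### The edge probabilities as contour integrals -/

/-- The contour formulas hold for the four probabilities at the faces in the colour class of the
outermost faces: both sides satisfy the same recurrence, and the integrals have the right values at
the faces just outside the Aztec diamond. -/
theorem edgeProb_eq_moment {ρ₁ ρ₂ : ℝ} (hρ : SmallRadii ρ₁ ρ₂) (n : ℕ) :
    ∀ (j k : ℤ) (a b c : ℕ), |j| + |k| < (n : ℤ) → 2 * (a : ℤ) = n + 1 + j + k →
      2 * (b : ℤ) = n + 1 - j + k → 2 * (c : ℤ) = n + 1 + j - k →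
      (pE j k n : ℂ) = moment ρ₁ ρ₂ a b c (fun z _ => 1 / (1 + z)) ∧
      (pN j k n : ℂ) = -moment ρ₁ ρ₂ a b c (fun z _ => 1 / (z - 1)) ∧
      (pW j k n : ℂ) = moment ρ₁ ρ₂ a b c (fun z w => 1 / (w * (z - 1))) + 1 ∧
      (pS j k n : ℂ) = moment ρ₁ ρ₂ a b c (fun z w => 1 / (w * (1 + z))) := by
  induction n with
  | zero =>
    intro j k a b c h
    have := abs_nonneg j
    have := abs_nonneg k
    push_cast at h
    omega
  | succ n ih =>
    intro j k a b c h ha hb hc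
    have h' : |j| + |k| ≤ (n : ℤ) := by push_cast at h; omega
    have hpar : (j + k + n) % 2 = 0 := by push_cast at ha; omega
    obtain ⟨hE, hN, hW, hS⟩ := edgeProb_face_succ h' hpar
    have h'' := h'
    simp only [Int.abs_eq_natAbs] at h''
    obtain ⟨a, rfl⟩ : ∃ m, a = m + 1 := ⟨a - 1, by omega⟩
    obtain ⟨b, rfl⟩ : ∃ m, b = m + 1 := ⟨b - 1, by omega⟩
    obtain ⟨c, rfl⟩ : ∃ m, c = m + 1 := ⟨c - 1, by omega⟩
    have ha' : 2 * (a : ℤ) = n + j + k := by push_cast at ha; omega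
    have hb' : 2 * (b : ℤ) = n - j + k := by push_cast at hb; omega
    have hc' : 2 * (c : ℤ) = n + j - k := by push_cast at hc; omega
    have nE : (pE (j - 1) k n : ℂ) = moment ρ₁ ρ₂ a (b + 1) c (fun z _ => 1 / (1 + z)) := by
      by_cases hf : |j - 1| + |k| < (n : ℤ)
      · exact (ih (j - 1) k a (b + 1) c hf (by omega) (by push_cast; omega) (by omega)).1
      · have h0 : pE (j - 1) k n = 0 :=
          edgeProb_eq_zero (side_notMem_aztecEdges (q := (j - 1, k)) (by simp only; omega)
            (not_lt.1 hf) 0)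
        rw [h0, ofReal_zero]
        simp only [Int.abs_eq_natAbs] at hf
        have : a = 0 ∨ c = 0 := by omega
        rcases this with rfl | rfl
        · exact (moment_east_left hρ _ _).symm
        · exact (moment_east_right hρ _ _).symm
    have nN : (pN j (k - 1) n : ℂ) = -moment ρ₁ ρ₂ a b (c + 1) (fun z _ => 1 / (z - 1)) := by
      by_cases hf : |j| + |k - 1| < (n : ℤ)
      · exact (ih j (k - 1) a b (c + 1) hf (by omega) (by omega) (by push_cast; omega)).2.1
      · have h0 : pN j (k - 1) n = 0 :=
          edgeProb_eq_zero (side_notMem_aztecEdges (q := (j, k - 1)) (by simp only; omega)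
            (not_lt.1 hf) 1)
        rw [h0, ofReal_zero, zero_eq_neg]
        simp only [Int.abs_eq_natAbs] at hf
        have : a = 0 ∨ b = 0 := by omega
        rcases this with rfl | rfl
        · exact moment_north_left hρ _ _
        · exact moment_north_bottom hρ (by omega)
    have nW : (pW (j + 1) k n : ℂ) =
        moment ρ₁ ρ₂ (a + 1) b (c + 1) (fun z w => 1 / (w * (z - 1))) + 1 := by
      by_cases hf : |j + 1| + |k| < (n : ℤ)
      · exact (ih (j + 1) k (a + 1) b (c + 1) hf (by push_cast; omega) (by omega)
          (by push_cast; omega)).2.2.1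
      · have h0 : pW (j + 1) k n = 0 :=
          edgeProb_eq_zero (side_notMem_aztecEdges (q := (j + 1, k)) (by simp only; omega)
            (not_lt.1 hf) 2)
        rw [h0, ofReal_zero]
        simp only [Int.abs_eq_natAbs] at hf
        have : b = 0 ∨ a + 1 = b + (c + 1) := by omega
        rcases this with rfl | h1
        · rw [moment_west_bottom hρ (by omega) (by omega)]
          ring
        · rw [h1, moment_west_top hρ (by omega)]
          ring
    have nS : (pS j (k + 1) n : ℂ) =
        moment ρ₁ ρ₂ (a + 1) (b + 1) c (fun z w => 1 / (w * (1 + z))) := by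
      by_cases hf : |j| + |k + 1| < (n : ℤ)
      · exact (ih j (k + 1) (a + 1) (b + 1) c hf (by push_cast; omega) (by push_cast; omega)
          (by omega)).2.2.2
      · have h0 : pS j (k + 1) n = 0 :=
          edgeProb_eq_zero (side_notMem_aztecEdges (q := (j, k + 1)) (by simp only; omega)
            (not_lt.1 hf) 3)
        rw [h0, ofReal_zero]
        simp only [Int.abs_eq_natAbs] at hf
        have : c = 0 ∨ a + 1 = b + 1 + c := by omega
        rcases this with rfl | h1
        · exact (moment_south_right hρ _ _).symm
        · rw [h1, moment_south_top hρ (by omega)]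
    rw [hE, hN, hW, hS, moment_shuffle_east hρ, moment_shuffle_north hρ, moment_shuffle_west hρ,
      moment_shuffle_south hρ]
    push_cast
    rw [nE, nN, nW, nS]
    refine ⟨?_, ?_, ?_, ?_⟩ <;> ring

/-! ### Positions in the t-embedding -/

section
variable {ρ₁ ρ₂ : ℝ} (hρ : SmallRadii ρ₁ ρ₂)
include hρ

/-- The contour formula satisfies the shuffling rule. With `a, b, c, d` the exponents before the
shuffle, a zero among them puts the face itself outside the old graph, and puts those neighbours
outside the graph for which it does not increase. At these faces the actual positions
differ from the contour formula, but the differences cancel in the wave equation. -/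
theorem moment_GT_shuffle {a b c d : ℕ} (h : a + d = b + c) {E N W S O : ℂ}
    (hE : E = if b ≠ 0 ∧ d ≠ 0 then moment ρ₁ ρ₂ (a + 1) b (c + 1) GT - 1
      else if b = 0 ∧ d = 0 then 1 else 0)
    (hN : N = if c ≠ 0 ∧ d ≠ 0 then moment ρ₁ ρ₂ (a + 1) (b + 1) c GT - 1
      else if c = 0 ∧ d = 0 then I else 0)
    (hW : W = if a ≠ 0 ∧ c ≠ 0 then moment ρ₁ ρ₂ a (b + 1) c GT - 1
      else if a = 0 ∧ c = 0 then -1 else 0)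
    (hS : S = if a ≠ 0 ∧ b ≠ 0 then moment ρ₁ ρ₂ a b (c + 1) GT - 1
      else if a = 0 ∧ b = 0 then -I else 0)
    (hO : O = if a ≠ 0 ∧ b ≠ 0 ∧ c ≠ 0 ∧ d ≠ 0 then moment ρ₁ ρ₂ a b c GT - 1 else 0) :
    (E + W + N + S) / 2 - O = moment ρ₁ ρ₂ (a + 1) (b + 1) (c + 1) GT - 1 := by
  rw [moment_wave hρ a b c (contourContinuous_GT hρ), hE, hN, hW, hS, hO]
  have vEb : b = 0 → d ≠ 0 → moment ρ₁ ρ₂ (a + 1) b (c + 1) GT = 1 - I := by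
    rintro rfl _; exact moment_GT_bottom hρ (by omega) (by omega)
  have vEd : b ≠ 0 → d = 0 → moment ρ₁ ρ₂ (a + 1) b (c + 1) GT = 1 + I := by
    rintro hb rfl
    rw [show a + 1 = b + (c + 1) by omega]
    exact moment_GT_top hρ hb (by omega)
  have vEbd : b = 0 → d = 0 → moment ρ₁ ρ₂ (a + 1) b (c + 1) GT = 2 ^ (a + 1) := by
    rintro rfl rfl
    rw [show c = a by omega]
    exact moment_GT_corner hρ (by omega)
  have vNc : c = 0 → moment ρ₁ ρ₂ (a + 1) (b + 1) c GT = 0 := by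
    rintro rfl; exact moment_GT_right hρ _ _
  have vNd : c ≠ 0 → d = 0 → moment ρ₁ ρ₂ (a + 1) (b + 1) c GT = 1 + I := by
    rintro hc rfl
    rw [show a + 1 = b + 1 + c by omega]
    exact moment_GT_top hρ (by omega) hc
  have vWa : a = 0 → moment ρ₁ ρ₂ a (b + 1) c GT = 0 := by
    rintro rfl; exact moment_GT_left hρ _ _
  have vWc : c = 0 → moment ρ₁ ρ₂ a (b + 1) c GT = 0 := by
    rintro rfl; exact moment_GT_right hρ _ _
  have vSa : a = 0 → moment ρ₁ ρ₂ a b (c + 1) GT = 0 := by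
    rintro rfl; exact moment_GT_left hρ _ _
  have vSb : a ≠ 0 → b = 0 → moment ρ₁ ρ₂ a b (c + 1) GT = 1 - I := by
    rintro ha rfl; exact moment_GT_bottom hρ ha (by omega)
  have vOa : a = 0 → moment ρ₁ ρ₂ a b c GT = 0 := by
    rintro rfl; exact moment_GT_left hρ _ _
  have vOc : c = 0 → moment ρ₁ ρ₂ a b c GT = 0 := by
    rintro rfl; exact moment_GT_right hρ _ _
  have vOb : a ≠ 0 → b = 0 → d ≠ 0 → moment ρ₁ ρ₂ a b c GT = 1 - I := by
    rintro ha rfl _; exact moment_GT_bottom hρ ha (by omega)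
  have vOd : b ≠ 0 → c ≠ 0 → d = 0 → moment ρ₁ ρ₂ a b c GT = 1 + I := by
    rintro hb hc rfl
    rw [show a = b + c by omega]
    exact moment_GT_top hρ hb hc
  have vObd : a ≠ 0 → b = 0 → d = 0 → moment ρ₁ ρ₂ a b c GT = 2 ^ a := by
    rintro ha rfl rfl
    rw [show c = a by omega]
    exact moment_GT_corner hρ ha
  by_cases ha : a = 0 <;> by_cases hb : b = 0 <;> by_cases hc : c = 0 <;> by_cases hd : d = 0 <;>
    first
    | (exfalso; omega)
    | skip
  · rw [vEbd hb hd, vNc hc, vWa ha, vSa ha, vOa ha]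
    simp [ha, hb, hc, hd]
  · rw [vEb hb hd, vWa ha, vSa ha, vOa ha]
    simp [ha, hb, hc, hd]
    ring
  · rw [vNc hc, vWa ha, vSa ha, vOa ha]
    simp [ha, hb, hc, hd]
    ring
  · rw [vWa ha, vSa ha, vOa ha]
    simp [ha, hb, hc, hd]
    ring
  · rw [vEbd hb hd, vNd hc hd, vSb ha hb, vObd ha hb hd]
    simp [ha, hb, hc, hd]
    ring
  · rw [vEb hb hd, vSb ha hb, vOb ha hb hd]
    simp [ha, hb, hc, hd]
    ring
  · rw [vEd hb hd, vNc hc, vWc hc, vOc hc]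
    simp [ha, hb, hc, hd]
    ring
  · rw [vNc hc, vWc hc, vOc hc]
    simp [ha, hb, hc, hd]
    ring
  · rw [vEd hb hd, vNd hc hd, vOd hb hc hd]
    simp [ha, hb, hc, hd]
    ring
  · simp [ha, hb, hc, hd]
    ring

/-- The formula for the positions along any sequence of shuffles, with the properties of the
column heights that are preserved along it. -/
theorem isTEmbedding_eq_moment {H : ℤ → ℤ} {T : ℤ → ℤ → ℂ} (hT : IsTEmbedding H T) :
    (∀ c, |c| - 1 ≤ H c ∧ (H c + c) % 2 = 1) ∧
    ∀ j k, (¬IsFace H j k → T j k = 0) ∧ (IsFace H j k → ∀ a b c : ℕ,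
      2 * (a : ℤ) = H (j + k) + 1 + j + k → 2 * (b : ℤ) = H (j + k) + 1 - j + k →
      2 * (c : ℤ) = H (j + k) + 1 + j - k → T j k = moment ρ₁ ρ₂ a b c GT - 1) := by
  induction hT with
  | empty =>
    refine ⟨fun c => ?_, fun j k => ⟨fun _ => rfl, fun h => ?_⟩⟩
    · simp only [emptyPath, Int.abs_eq_natAbs]
      omega
    · simp only [IsFace, emptyPath, Int.abs_eq_natAbs] at h
      omega
  | step H T c hT hl hr ih =>
    obtain ⟨hH, hF⟩ := ih
    have hflip : ∀ x, flip H c x = if x = c then H c + 2 else H x := by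
      intro x
      unfold flip
      rw [Function.update_apply]
    refine ⟨fun x => ?_, fun j k => ?_⟩
    · have h1 := hH x
      rw [hflip]
      split_ifs with h
      · subst h
        omega
      · exact h1
    by_cases hjk : j + k = c
    · subst hjk
      have hface : IsFace (flip H (j + k)) j k ↔ |j| + |k| < H (j + k) + 2 := by
        unfold IsFace
        rw [hflip, if_pos rfl]
      constructor
      · intro h
        rw [shuffle, if_neg (fun h' => h h'.2)]
        refine (hF j k).1 fun h' => h (hface.2 ?_)
        unfold IsFace at h'
        omega
      · intro h a b c ha hb hc
        rw [shuffle, if_pos ⟨rfl, h⟩]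
        rw [hface] at h
        rw [hflip, if_pos rfl] at ha hb hc
        simp only [Int.abs_eq_natAbs] at h
        obtain ⟨a, rfl⟩ : ∃ m, a = m + 1 := ⟨a - 1, by omega⟩
        obtain ⟨b, rfl⟩ : ∃ m, b = m + 1 := ⟨b - 1, by omega⟩
        obtain ⟨c, rfl⟩ : ∃ m, c = m + 1 := ⟨c - 1, by omega⟩
        obtain ⟨d, hd⟩ : ∃ d : ℕ, 2 * (d : ℤ) = H (j + k) + 1 - j - k :=
          ⟨((H (j + k) + 1 - j - k) / 2).toNat, by omega⟩
        push_cast at ha hb hc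
        have eE : j + 1 + k = j + k + 1 := by ring
        have eW : j - 1 + k = j + k - 1 := by ring
        have eN : j + (k + 1) = j + k + 1 := by ring
        have eS : j + (k - 1) = j + k - 1 := by ring
        refine moment_GT_shuffle hρ (d := d) (by omega) ?_ ?_ ?_ ?_ ?_
        · have hiff : IsFace H (j + 1) k ↔ b ≠ 0 ∧ d ≠ 0 := by
            rw [IsFace, eE, hr, Int.abs_eq_natAbs, Int.abs_eq_natAbs]
            omega
          unfold neighborValue
          by_cases hf : b ≠ 0 ∧ d ≠ 0
          · rw [if_pos (hiff.2 hf), if_pos hf]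
            exact (hF (j + 1) k).2 (hiff.2 hf) _ _ _ (by rw [eE]; push_cast; omega)
              (by rw [eE]; omega) (by rw [eE]; push_cast; omega)
          · rw [if_neg (hiff.not.2 hf), if_neg hf]
            split_ifs <;> first | rfl | (exfalso; omega)
        · have hiff : IsFace H j (k + 1) ↔ c ≠ 0 ∧ d ≠ 0 := by
            rw [IsFace, eN, hr, Int.abs_eq_natAbs, Int.abs_eq_natAbs]
            omega
          unfold neighborValue
          by_cases hf : c ≠ 0 ∧ d ≠ 0
          · rw [if_pos (hiff.2 hf), if_pos hf]
            exact (hF j (k + 1)).2 (hiff.2 hf) _ _ _ (by rw [eN]; push_cast; omega)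
              (by rw [eN]; push_cast; omega) (by rw [eN]; omega)
          · rw [if_neg (hiff.not.2 hf), if_neg hf]
            split_ifs <;> first | rfl | (exfalso; omega)
        · have hiff : IsFace H (j - 1) k ↔ a ≠ 0 ∧ c ≠ 0 := by
            rw [IsFace, eW, hl, Int.abs_eq_natAbs, Int.abs_eq_natAbs]
            omega
          unfold neighborValue
          by_cases hf : a ≠ 0 ∧ c ≠ 0
          · rw [if_pos (hiff.2 hf), if_pos hf]
            exact (hF (j - 1) k).2 (hiff.2 hf) _ _ _ (by rw [eW]; omega)
              (by rw [eW]; push_cast; omega) (by rw [eW]; omega)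
          · rw [if_neg (hiff.not.2 hf), if_neg hf]
            split_ifs <;> first | rfl | (exfalso; omega)
        · have hiff : IsFace H j (k - 1) ↔ a ≠ 0 ∧ b ≠ 0 := by
            rw [IsFace, eS, hl, Int.abs_eq_natAbs, Int.abs_eq_natAbs]
            omega
          unfold neighborValue
          by_cases hf : a ≠ 0 ∧ b ≠ 0
          · rw [if_pos (hiff.2 hf), if_pos hf]
            exact (hF j (k - 1)).2 (hiff.2 hf) _ _ _ (by rw [eS]; omega)
              (by rw [eS]; omega) (by rw [eS]; push_cast; omega)
          · rw [if_neg (hiff.not.2 hf), if_neg hf]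
            split_ifs <;> first | rfl | (exfalso; omega)
        · have hiff : IsFace H j k ↔ a ≠ 0 ∧ b ≠ 0 ∧ c ≠ 0 ∧ d ≠ 0 := by
            rw [IsFace, Int.abs_eq_natAbs, Int.abs_eq_natAbs]
            omega
          by_cases hf : a ≠ 0 ∧ b ≠ 0 ∧ c ≠ 0 ∧ d ≠ 0
          · rw [if_pos hf]
            exact (hF j k).2 (hiff.2 hf) _ _ _ (by omega) (by omega) (by omega)
          · rw [if_neg hf]
            exact (hF j k).1 (hiff.not.2 hf)
    · have hface : IsFace (flip H c) j k ↔ IsFace H j k := by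
        unfold IsFace
        rw [hflip, if_neg hjk]
      rw [shuffle, if_neg (fun h => hjk h.1), hface, hflip, if_neg hjk]
      exact hF j k

end

/-! ### Reaching a path by corner flips -/

/-- An up-down path lies above the path of the empty graph. -/
theorem IsUpDownPath.emptyPath_le {H : ℤ → ℤ} (hH : IsUpDownPath H) (c : ℤ) :
    emptyPath c ≤ H c := by
  obtain ⟨hstep, L, hL⟩ := hH
  have hlip : ∀ (m : ℕ) (x : ℤ), H (x + m) - H x ≤ m ∧ H x - H (x + m) ≤ m := by
    intro m x
    induction m with
    | zero => simp
    | succ m ih =>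
      have := hstep (x + m)
      push_cast
      rw [← add_assoc]
      omega
  simp only [emptyPath, Int.abs_eq_natAbs] at *
  rcases le_total 0 c with h | h
  · have h1 := hlip (max L.toNat c.toNat - c).toNat c
    have h2 := hL (c + (max L.toNat c.toNat - c).toNat) (by omega)
    omega
  · have h1 := hlip (max L.toNat (-c).toNat + c).toNat (c - (max L.toNat (-c).toNat + c).toNat)
    have h2 := hL (c - (max L.toNat (-c).toNat + c).toNat) (by omega)
    rw [sub_add_cancel] at h1
    omega

/-- Every up-down path is reached from the empty one: a highest point among those above
the empty path is a local maximum, and lowering it there leaves a smaller up-down path. -/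
theorem IsUpDownPath.exists_isTEmbedding {H : ℤ → ℤ} (hH : IsUpDownPath H) :
    ∃ T, IsTEmbedding H T := by
  obtain ⟨L, hL⟩ := hH.2
  obtain ⟨m, hm⟩ : ∃ m : ℕ, ∑ c ∈ Finset.Icc (-L) L, (H c - emptyPath c).toNat = m := ⟨_, rfl⟩
  induction m using Nat.strong_induction_on generalizing H with
  | _ m ih =>
    by_cases hne : ∃ c, emptyPath c < H c
    · have hmem : ∀ c, emptyPath c < H c → c ∈ Finset.Icc (-L) L := by
        intro c hc
        rw [Finset.mem_Icc, ← abs_le]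
        by_contra h
        rw [hL c (by omega)] at hc
        exact lt_irrefl _ hc
      obtain ⟨c, hc, hmax⟩ := Finset.exists_max_image
        ((Finset.Icc (-L) L).filter (fun c => emptyPath c < H c)) H
        (by obtain ⟨c, hc⟩ := hne; exact ⟨c, Finset.mem_filter.2 ⟨hmem c hc, hc⟩⟩)
      have hc' : emptyPath c < H c := (Finset.mem_filter.1 hc).2
      have hmax' : ∀ x, emptyPath x < H x → H x ≤ H c := fun x hx =>
        hmax x (Finset.mem_filter.2 ⟨hmem x hx, hx⟩)
      have hr : H (c + 1) = H c - 1 := by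
        rcases hH.1 c with h | h
        · exfalso
          have h1 := hmax' (c + 1)
          simp only [emptyPath, Int.abs_eq_natAbs] at h1 hc'
          omega
        · omega
      have hl : H (c - 1) = H c - 1 := by
        have h := hH.1 (c - 1)
        rw [sub_add_cancel] at h
        rcases h with h | h
        · omega
        · exfalso
          have h1 := hmax' (c - 1)
          simp only [emptyPath, Int.abs_eq_natAbs] at h1 hc'
          omega
      set H' : ℤ → ℤ := Function.update H c (H c - 2) with hH'
      have happ : ∀ x, H' x = if x = c then H c - 2 else H x := fun x => by
        rw [hH', Function.update_apply]
      have hL' : ∀ x, L ≤ |x| → H' x = emptyPath x := by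
        intro x hx
        rw [happ, if_neg, hL x hx]
        rintro rfl
        rw [hL x hx] at hc'
        exact lt_irrefl _ hc'
      have hup : IsUpDownPath H' := by
        refine ⟨fun x => ?_, L, hL'⟩
        have h := hH.1 x
        rw [happ, happ]
        split_ifs with h1 h2 h2
        · omega
        · rw [show x = c - 1 by omega]
          omega
        · subst h2
          omega
        · exact h
      have hlt : ∑ x ∈ Finset.Icc (-L) L, (H' x - emptyPath x).toNat < m := by
        rw [← hm]
        refine Finset.sum_lt_sum (fun x _ => ?_) ⟨c, hmem c hc', ?_⟩
        · rw [happ]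
          split_ifs with h
          · subst h
            omega
          · exact le_rfl
        · rw [happ, if_pos rfl]
          omega
      obtain ⟨T, hT⟩ := ih _ hlt hup hL' rfl
      have hflip : flip H' c = H := by
        unfold flip
        rw [happ, if_pos rfl, hH', Function.update_idem, sub_add_cancel, Function.update_eq_self]
      refine ⟨shuffle H' T c, hflip ▸ IsTEmbedding.step H' T c hT ?_ ?_⟩
      · rw [happ, happ, if_neg (by omega), if_pos rfl]
        omega
      · rw [happ, happ, if_neg (by omega), if_pos rfl]
        omega
    · have : H = emptyPath := funext fun c =>
        le_antisymm (not_lt.1 fun h => hne ⟨c, h⟩) (hH.emptyPath_le c)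
      exact ⟨_, this ▸ IsTEmbedding.empty⟩

end Tower

end

theorem mainTheorem7 (f : ℝ → ℝ) (xs : ℝ) (hf : Tower.IsProfile f xs)
    (n N : ℕ) (hN : N = n ∨ N = n + 1)
    (H : ℤ → ℤ) (hH : Tower.IsApproxPath f xs N H)
    (l₀ l₁ l₂ : ℂ → ℂ) (hl₀ : Tower.IsLogBranch l₀) (hl₁ : Tower.IsLogBranch l₁)
    (hl₂ : Tower.IsLogBranch l₂)
    (ρ₁ ρ₂ : ℝ) (hρ₁ : 0 < ρ₁) (hρ₁' : ρ₁ < 1 / 2) (hρ₂ : 0 < ρ₂) (hρ₂' : ρ₂ < 1 / 2) :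
    (∀ j k : ℤ, Tower.IsFace H j k →
      ((Tower.pE j k (Tower.rIndex H j k) : ℝ) : ℂ) =
        Tower.contourFormula f xs n H l₀ l₁ l₂ ρ₁ ρ₂ j k (fun z _ => 1 / (1 + z)) ∧
      ((Tower.pN j k (Tower.rIndex H j k) : ℝ) : ℂ) =
        -Tower.contourFormula f xs n H l₀ l₁ l₂ ρ₁ ρ₂ j k (fun z _ => 1 / (z - 1)) ∧
      ((Tower.pW j k (Tower.rIndex H j k) : ℝ) : ℂ) =
        Tower.contourFormula f xs n H l₀ l₁ l₂ ρ₁ ρ₂ j k (fun z w => 1 / (w * (z - 1))) + 1 ∧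
      ((Tower.pS j k (Tower.rIndex H j k) : ℝ) : ℂ) =
        Tower.contourFormula f xs n H l₀ l₁ l₂ ρ₁ ρ₂ j k (fun z w => 1 / (w * (1 + z)))) ∧
    (∃ T : ℤ → ℤ → ℂ, Tower.IsTEmbedding H T) ∧
    (∀ T : ℤ → ℤ → ℂ, Tower.IsTEmbedding H T → ∀ j k : ℤ, Tower.IsFace H j k →
      T j k = Tower.contourFormula f xs n H l₀ l₁ l₂ ρ₁ ρ₂ j k Tower.GT - 1) := by
  have hρ : Tower.SmallRadii ρ₁ ρ₂ := ⟨hρ₁, hρ₁', hρ₂, hρ₂'⟩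
  obtain ⟨T₀, hT₀⟩ := hH.1.1.exists_isTEmbedding
  have hpar := (Tower.isTEmbedding_eq_moment hρ hT₀).1
  have hexp : ∀ j k : ℤ, Tower.IsFace H j k → (Tower.rIndex H j k : ℤ) = H (j + k) ∧
      ∃ a b c : ℕ, 2 * (a : ℤ) = Tower.rIndex H j k + 1 + j + k ∧
        2 * (b : ℤ) = Tower.rIndex H j k + 1 - j + k ∧
        2 * (c : ℤ) = Tower.rIndex H j k + 1 + j - k := by
    intro j k h
    have h1 := (hpar (j + k)).2
    simp only [Tower.IsFace, Int.abs_eq_natAbs] at h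
    have h2 : (Tower.rIndex H j k : ℤ) = H (j + k) := Int.toNat_of_nonneg (by omega)
    refine ⟨h2, ((H (j + k) + 1 + j + k) / 2).toNat, ((H (j + k) + 1 - j + k) / 2).toNat,
      ((H (j + k) + 1 + j - k) / 2).toNat, ?_, ?_, ?_⟩ <;> omega
  refine ⟨fun j k h => ?_, ⟨T₀, hT₀⟩, fun T hT j k h => ?_⟩
  · obtain ⟨hr, a, b, c, ha, hb, hc⟩ := hexp j k h
    simp only [Tower.contourFormula_eq_moment hl₀ hl₁ hl₂ hρ ha hb hc]
    exact Tower.edgeProb_eq_moment hρ _ j k a b c (by rw [hr]; exact h) ha hb hc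
  · obtain ⟨hr, a, b, c, ha, hb, hc⟩ := hexp j k h
    rw [Tower.contourFormula_eq_moment hl₀ hl₁ hl₂ hρ ha hb hc]
    exact ((Tower.isTEmbedding_eq_moment hρ hT).2 j k).2 h a b c (hr ▸ ha) (hr ▸ hb) (hr ▸ hc)
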